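/- Let $G$ be a Carnot group of step $r$, i.e. a connected, simply connected, nilpotent Lie group whose Lie algebra has a stratification $\mathfrak g=V_1\oplus\dots\oplus V_r$ with $[V_1,V_j]=V_{j+1}$ for $1\le j\le r-1$ and $[V_i,V_j]\subset V_{i+j}$ (where $V_l=\{0\}$ for $l>r$), equipped with a scalar product on $\mathfrak g$ for which the $V_j$ are mutually orthogonal. Let $d=\dim V_1$ be the rank of the horizontal distribution, let $X_1,\dots,X_d$ be the left invariant vector fields that coincide at the identity with an orthonormal basis of $V_1$, and let $\Delta_H=\sum_{i\le d}X_iX_i$ be the horizontal Laplacian. Let $v_G$ be the Riemannian volume element of the left invariant metric defined by the scalar product, or more generally any Haar measure on $G$. Let $\Omega\subset G$ be a bounded (relatively compact) domain and let $V$ be a measurable real function on $\Omega$ such that the operator $-\Delta_H+V$ on $L^2(\Omega,v_G)$ with Dirichlet boundary conditions has purely discrete spectrum bounded from below. Here this operator is the one associated with the quadratic form $\int_\Omega\big(\sum_i|X_iu|^2+Vu^2\big)\,v_G$ on the set of those $u\in S^1_0(\Omega)$ with $\int_\Omega|V|u^2\,v_G<\infty$, where $S^1_0(\Omega)$ is the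 closure of $C_c^\infty(\Omega)$ for the norm $\big(\|u\|_{L^2}^2+\sum_i\|X_iu\|_{L^2}^2\big)^{1/2}$. Let $\lambda_1\le\lambda_2\le\dots\to\infty$ be its eigenvalues, repeated according to multiplicity, let $\{u_i\}_{i\ge1}$ be a complete orthonormal family of corresponding real eigenfunctions, and put $T_i=\int_\Omega Vu_i^2\,v_G$. Then for every $k\ge1$ and every $p\in\mathbb R$ (assuming $\lambda_{k+1}>\lambda_k$ if $p<1$, so that all the powers are defined; $0^0=1$ if $p=1$), $$\sum_{i=1}^k(\lambda_{k+1}-\lambda_i)^p\le\frac{\max\{4,2p\}}{d}\sum_{i=1}^k(\lambda_{k+1}-\lambda_i)^{p-1}(\lambda_i-T_i).$$ Moreover, if $V$ is bounded below on $\Omega$, then for every $k\ge1$ $$\lambda_{k+1}\le\Big(1+\frac4d\Big)\frac1k\sum_{i=1}^k\lambda_i-\frac4d\inf_\Omega V$$ and $$\lambda_{k+1}\le\Big(1+\frac4d\Big)k^{2/d}\lambda_1-\Big(\Big(1+\frac4d\Big)k^{2/d}-1\Big)\inf_\Omega V.$$ -/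

import Mathlib

open MeasureTheory Filter Topology Set
open scoped Manifold ContDiff

noncomputable section

/-- The Lie algebra of an `n`-dimensional Lie group `G`: the tangent space at the identity, with
Mathlib's bracket of left invariant vector fields. -/
abbrev LieAlg (n : ℕ) (G : Type*) [TopologicalSpace G] [ChartedSpace (EuclideanSpace ℝ (Fin n)) G]
    [Group G] : Type :=
  GroupLieAlgebra (𝓡 n) G

/-- A Carnot group of step `r`: a (connected and) simply connected nilpotent Lie group whose Lie
algebra is stratified, `𝔤 = V₁ ⊕ ⋯ ⊕ V_r`, together with a scalar product on `𝔤` for which the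
layers are mutually orthogonal. The layers are indexed by `ℕ`, those outside `1, …, r` being
zero. (Mathlib's `SimplyConnectedSpace` includes path connectedness.) -/
structure CarnotGroup (n : ℕ) (G : Type*) [TopologicalSpace G]
    [ChartedSpace (EuclideanSpace ℝ (Fin n)) G] [Group G] [LieGroup (𝓡 n) ∞ G] where
  simplyConnected : SimplyConnectedSpace G
  nilpotent : Group.IsNilpotent G
  /-- the step -/
  step : ℕ
  /-- the layers of the stratification -/
  layer : ℕ → Submodule ℝ (LieAlg n G)
  layer_zero : layer 0 = ⊥
  layer_of_step_lt : ∀ j, step < j → layer j = ⊥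
  layer_isInternal : DirectSum.IsInternal layer
  bracket_layer_one : ∀ j, 1 ≤ j → j < step →
    Submodule.span ℝ {z : LieAlg n G | ∃ x ∈ layer 1, ∃ y ∈ layer j, z = ⁅x, y⁆} = layer (j + 1)
  bracket_mem : ∀ i j, 1 ≤ i → 1 ≤ j → ∀ x ∈ layer i, ∀ y ∈ layer j, ⁅x, y⁆ ∈ layer (i + j)
  /-- the scalar product on the Lie algebra -/
  scalar : LinearMap.BilinForm ℝ (LieAlg n G)
  scalar_symm : ∀ x y, scalar x y = scalar y x
  scalar_pos : ∀ x, x ≠ 0 → 0 < scalar x x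
  scalar_layer : ∀ i j, i ≠ j → ∀ x ∈ layer i, ∀ y ∈ layer j, scalar x y = 0

section

variable {n : ℕ} {G : Type*} [TopologicalSpace G] [ChartedSpace (EuclideanSpace ℝ (Fin n)) G]
  [Group G]

/-- The rank of the horizontal distribution, i.e. the dimension of the first layer. -/
def CarnotGroup.rank [LieGroup (𝓡 n) ∞ G] (C : CarnotGroup n G) : ℕ :=
  Module.finrank ℝ (C.layer 1)

/-- `e` is an orthonormal basis of the first layer. -/
def CarnotGroup.IsHorizontalFrame [LieGroup (𝓡 n) ∞ G] (C : CarnotGroup n G)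
    (e : Fin C.rank → LieAlg n G) : Prop :=
  Submodule.span ℝ (Set.range e) = C.layer 1 ∧
    ∀ i j, C.scalar (e i) (e j) = if i = j then 1 else 0

/-- The derivative `X · φ` of `φ` along the left invariant vector field `X` with `X(1) = v`. -/
def invariantDeriv (v : LieAlg n G) (φ : G → ℝ) (g : G) : ℝ :=
  mfderiv (𝓡 n) 𝓘(ℝ, ℝ) φ g (mulInvariantVectorField v g)

/-- Smooth real functions on `G` with compact support contained in `Ω`. -/
def IsTestFunction (n : ℕ) {G : Type*} [TopologicalSpace G]
    [ChartedSpace (EuclideanSpace ℝ (Fin n)) G] (Ω : Set G) (φ : G → ℝ) : Prop :=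
  ContMDiff (𝓡 n) 𝓘(ℝ, ℝ) ∞ φ ∧ HasCompactSupport φ ∧ tsupport φ ⊆ Ω

variable [MeasurableSpace G]

/-- The real Hilbert space `L²(Ω)`. -/
abbrev L2 (μ : Measure G) (Ω : Set G) : Type _ := Lp ℝ 2 (μ.restrict Ω)

variable {d : ℕ}

/-- The horizontal Sobolev space `S¹₀(Ω)` (functions vanishing on the boundary): the closure, with
respect to the norm `(‖u‖² + ∑ᵢ ‖Xᵢ u‖²)^(1/2)` with `L²(Ω)` norms, of the test functions. An
element is recorded together with its horizontal gradient, as a pair `(u, (X₁u, …, X_d u))`; here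
`Xᵢ` is the left invariant vector field with `Xᵢ(1) = e i`. -/
def horizontalSobolevZero (μ : Measure G) (Ω : Set G) (e : Fin d → LieAlg n G) :
    Set (L2 μ Ω × (Fin d → L2 μ Ω)) :=
  closure {q | ∃ φ : G → ℝ, IsTestFunction n Ω φ ∧ q.1 =ᵐ[μ.restrict Ω] φ ∧
    ∀ i, q.2 i =ᵐ[μ.restrict Ω] invariantDeriv (e i) φ}

/-- The domain of the quadratic form of `-Δ_H + V` with Dirichlet boundary conditions on `Ω`:
the elements `u` of `S¹₀(Ω)` with `∫_Ω |V| u² < ∞`. -/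
def schrodingerFormDomain (μ : Measure G) (Ω : Set G) (e : Fin d → LieAlg n G) (V : G → ℝ) :
    Set (L2 μ Ω × (Fin d → L2 μ Ω)) :=
  {q | q ∈ horizontalSobolevZero μ Ω e ∧ Integrable (fun x => V x * q.1 x ^ 2) (μ.restrict Ω)}

/-- The bilinear form `∫_Ω ∑ᵢ (Xᵢ u) (Xᵢ φ) + ∫_Ω V u φ` of `-Δ_H + V`, `Δ_H = ∑ᵢ Xᵢ Xᵢ`. -/
def schrodingerForm (μ : Measure G) (Ω : Set G) (V : G → ℝ)
    (q q' : L2 μ Ω × (Fin d → L2 μ Ω)) : ℝ :=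
  (∑ i, ∫ x in Ω, q.2 i x * q'.2 i x ∂μ) + ∫ x in Ω, V x * (q.1 x * q'.1 x) ∂μ

/-- The operator `-Δ_H + V` on `L²(Ω)` with Dirichlet boundary conditions, given by its graph:
`u` lies in its domain and `(-Δ_H + V) u = f`. It is the operator associated with the quadratic
form above. -/
def IsDirichletSchrodinger (μ : Measure G) (Ω : Set G) (e : Fin d → LieAlg n G) (V : G → ℝ)
    (u f : L2 μ Ω) : Prop :=
  ∃ w : Fin d → L2 μ Ω, (u, w) ∈ schrodingerFormDomain μ Ω e V ∧
    ∀ q ∈ schrodingerFormDomain μ Ω e V,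
      schrodingerForm μ Ω V (u, w) q = ∫ x in Ω, f x * q.1 x ∂μ

/-- The operator `-Δ_H + V` on `Ω` with Dirichlet boundary conditions has purely discrete spectrum
bounded from below, `lam 0 ≤ lam 1 ≤ ⋯ → ∞` being its eigenvalues repeated according to
multiplicity, and `u 0, u 1, …` is a complete orthonormal family of corresponding
eigenfunctions. -/
structure HasDiscreteDirichletSpectrum (μ : Measure G) (Ω : Set G) (e : Fin d → LieAlg n G)
    (V : G → ℝ) (lam : ℕ → ℝ) (u : ℕ → L2 μ Ω) : Prop where
  monotone : Monotone lam
  tendsto : Tendsto lam atTop atTop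
  orthonormal : Orthonormal ℝ u
  complete : (Submodule.span ℝ (Set.range u)).topologicalClosure = ⊤
  eigen : ∀ j, IsDirichletSchrodinger μ Ω e V (u j) (lam j • u j)

end

end

/-! The engine is a pair of commutator sum rules. Fix j and let x be a function with Xᵢx = δᵢⱼ. Then
[-Δ_H + V, x] = -2Xⱼ and [Xⱼ, x] = 1. With a i l = ⟨x uᵢ, u_l⟩, Parseval turns these identities into
Σ_l (λ_l - λᵢ) a i l² = 1 and Σ_l (λ_l - λᵢ)² a i l² = 4‖Xⱼuᵢ‖² (`exists_sum_rules`). A purely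
algebraic inequality for symmetric matrices (`sum_rpow_mul_tsum_le`) compares the two sums with
weights (z - λᵢ)^p and (z - λᵢ)^(p-1). Summing over j gives d on the left, and Σⱼ‖Xⱼuᵢ‖² = λᵢ - Tᵢ
on the right.

The function x exists because eⱼ ∈ V₁ is orthogonal to all brackets: the left invariant form ⟨eⱼ, ·⟩
is closed by the Maurer–Cartan equation, hence exact on a simply connected group
(`exists_primitive`). It is bounded on Ω by compactness of the closure, so multiplication by x
preserves the form domain. The commutators are used only weakly, through integration by parts, which
holds because a nilpotent group is unimodular (`integral_invariantDeriv_eq_zero`).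

For V bounded below, Tᵢ ≥ inf V. The exponent p = 1 gives the bound by the mean. The exponent p = 2,
for every z and for the shifted eigenvalues λᵢ - inf V, is a differential inequality for their Riesz
mean, whose integration gives the last bound (`le_rpow_mul_of_yang`). -/

/-! ### Unimodularity of nilpotent groups -/

/-- Nilpotent locally compact groups are unimodular: a left Haar measure is right invariant. -/
theorem integral_mul_right_eq_self_of_isNilpotent {G : Type*} [Group G] [hG : Group.IsNilpotent G]
    [TopologicalSpace G] [IsTopologicalGroup G] [LocallyCompactSpace G] [T2Space G]
    [MeasurableSpace G] [BorelSpace G] (μ : Measure G) [μ.IsHaarMeasure] {f : G → ℝ}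
    (hf : Continuous f) (hfc : HasCompactSupport f) (h : G) :
    ∫ g, f (g * h) ∂μ = ∫ g, f g ∂μ := by
  -- Induction on the nilpotency class, through the quotient by the centre; topology and measure
  -- vary with the group.
  let P : ∀ (G : Type _) [Group G] [Group.IsNilpotent G], Prop := fun G _ _ =>
    ∀ [TopologicalSpace G] [IsTopologicalGroup G] [LocallyCompactSpace G] [T2Space G]
      [MeasurableSpace G] [BorelSpace G] (μ : Measure G) [μ.IsHaarMeasure] (f : G → ℝ),
      Continuous f → HasCompactSupport f → ∀ h : G, ∫ g, f (g * h) ∂μ = ∫ g, f g ∂μ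
  refine Group.nilpotent_center_quotient_ind (P := P) G ?_ ?_ μ f hf hfc h
  · intro G _ _ _ _ _ _ _ _ μ _ f _ _ h
    simp [Subsingleton.elim h 1]
  · intro G _ _ ih _ _ _ _ _ _ μ _ f hf hfc h
    have hcl : IsClosed (Subgroup.center G : Set G) := by
      have : (Subgroup.center G : Set G) = ⋂ g : G, {z | g * z = z * g} := by
        ext z
        simp [Subgroup.mem_center_iff]
      rw [this]
      exact isClosed_iInter fun g =>
        isClosed_eq (continuous_const.mul continuous_id) (continuous_id.mul continuous_const)
    have H := TopologicalGroup.IsSES.ofClosedSubgroup (Subgroup.center G) hcl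
    have : LocallyCompactSpace (Subgroup.center G) :=
      hcl.isClosedEmbedding_subtypeVal.locallyCompactSpace
    have : T2Space (G ⧸ Subgroup.center G) := by
      have : IsClosed ((Subgroup.center G : Subgroup G) : Set G) := hcl
      infer_instance
    let : MeasurableSpace (G ⧸ Subgroup.center G) := borel _
    have : BorelSpace (G ⧸ Subgroup.center G) := ⟨rfl⟩
    let μA : Measure (Subgroup.center G) := Measure.haar
    let μC : Measure (G ⧸ Subgroup.center G) := Measure.haar
    have hfh : Continuous fun g => f (g * h) := hf.comp (continuous_id.mul continuous_const)
    have hfhc : HasCompactSupport fun g => f (g * h) :=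
      hfc.comp_homeomorph (Homeomorph.mulRight h)
    -- By uniqueness of Haar measure, μ may be replaced by the measure that integrates first over
    -- the centre, then over the quotient.
    rw [Measure.integral_isMulLeftInvariant_eq_smul_of_hasCompactSupport μ
      (H.inducedMeasure μA μC) hf hfc,
      Measure.integral_isMulLeftInvariant_eq_smul_of_hasCompactSupport μ
      (H.inducedMeasure μA μC) hfh hfhc, integral_smul_nnreal_measure,
      integral_smul_nnreal_measure]
    congr 1
    let F : CompactlySupportedContinuousMap G ℝ := ⟨⟨f, hf⟩, hfc⟩
    let Fh : CompactlySupportedContinuousMap G ℝ := ⟨⟨fun g => f (g * h), hfh⟩, hfhc⟩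
    have e1 := H.integral_inducedMeasure μA μC F
    have e2 := H.integral_inducedMeasure μA μC Fh
    change ∫ g, Fh g ∂_ = ∫ g, F g ∂_
    -- Central elements commute with h, so fibre integration turns right translation by h into right
    -- translation by its class, which the induction hypothesis handles.
    rw [e1, e2, H.integrate_apply, H.integrate_apply,
      ← ih μC (H.pushforward μA F) (H.pushforward μA F).continuous
        (H.pushforward μA F).hasCompactSupport (QuotientGroup.mk' _ h)]
    congr 1
    ext c
    obtain ⟨b, rfl⟩ := H.isOpenQuotientMap.surjective c
    rw [← map_mul, H.pushforward_apply_apply, H.pushforward_apply_apply]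
    congr 1
    ext a
    simp only [H.pullback_def]
    change f (b * a * h) = f (b * h * a)
    rw [mul_assoc, mul_assoc, (Subgroup.mem_center_iff.1 a.2 h)]

/-! ### Power inequalities and the abstract commutator inequality -/

/-- For t > 0 the right side minus the left is st(t^(p-2) - s^(p-2)), nonnegative since p ≤ 2. -/
theorem rpow_sub_rpow_le_of_le_two {s t p : ℝ} (ht : 0 ≤ t) (hts : t ≤ s) (hp2 : p ≤ 2)
    (h : 1 ≤ p ∨ 0 < t) :
    s ^ p - t ^ p ≤ (s ^ (p - 1) + t ^ (p - 1)) * (s - t) := by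
  rcases ht.eq_or_lt with rfl | ht0
  · have hp1 : 1 ≤ p := by simpa using h
    rcases hts.eq_or_lt with rfl | hs
    · simp
    · rw [Real.zero_rpow (by linarith), sub_zero, sub_zero, add_mul, ← Real.rpow_add_one hs.ne']
      have : (0:ℝ) ≤ 0 ^ (p - 1) := Real.rpow_nonneg le_rfl _
      simpa using mul_nonneg this hs.le
  · have hs := ht0.trans_le hts
    have e1 : s ^ p = s ^ (p - 2) * s * s := by
      rw [← Real.rpow_add_one hs.ne', ← Real.rpow_add_one hs.ne']; ring_nf
    have e2 : t ^ p = t ^ (p - 2) * t * t := by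
      rw [← Real.rpow_add_one ht0.ne', ← Real.rpow_add_one ht0.ne']; ring_nf
    have e3 : s ^ (p - 1) = s ^ (p - 2) * s := by
      rw [← Real.rpow_add_one hs.ne']; ring_nf
    have e4 : t ^ (p - 1) = t ^ (p - 2) * t := by
      rw [← Real.rpow_add_one ht0.ne']; ring_nf
    have h1 : s ^ (p - 2) ≤ t ^ (p - 2) :=
      Real.rpow_le_rpow_of_nonpos ht0 hts (by linarith)
    have h2 : 0 ≤ s * t * (t ^ (p - 2) - s ^ (p - 2)) :=
      mul_nonneg (by positivity) (by linarith)
    rw [e1, e2, e3, e4]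
    nlinarith

/-- The trapezoidal rule overestimates the integral of p x^(p-1), which is convex for p ≥ 2. In the
proof, the difference has derivative p/2 times the gap between x^(p-1) and its tangent line,
evaluated at t. -/
theorem rpow_sub_rpow_le_of_two_le {s t p : ℝ} (ht : 0 ≤ t) (hts : t ≤ s) (hp : 2 ≤ p) :
    s ^ p - t ^ p ≤ p / 2 * (s ^ (p - 1) + t ^ (p - 1)) * (s - t) := by
  let h : ℝ → ℝ := fun x => p / 2 * (x ^ (p - 1) + t ^ (p - 1)) * (x - t) - x ^ p
  let h' : ℝ → ℝ := fun x => p / 2 * ((p - 1) * x ^ (p - 1 - 1)) * (x - t) +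
    p / 2 * (x ^ (p - 1) + t ^ (p - 1)) * 1 - p * x ^ (p - 1)
  have hd : ∀ x, HasDerivAt h (h' x) x := fun x => by
    have h1 : HasDerivAt (fun x : ℝ => x ^ (p - 1)) ((p - 1) * x ^ (p - 1 - 1)) x :=
      Real.hasDerivAt_rpow_const (Or.inr (by linarith))
    have h2 : HasDerivAt (fun x : ℝ => x ^ p) (p * x ^ (p - 1)) x :=
      Real.hasDerivAt_rpow_const (Or.inr (by linarith))
    exact (((h1.add_const _).const_mul _).mul ((hasDerivAt_id x).sub_const t)).sub h2
  have key : ∀ x, t < x → 0 ≤ h' x := fun x hx => by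
    have hx0 : 0 < x := ht.trans_lt hx
    have hconv : t ^ (p - 1) ≥ x ^ (p - 1) + (p - 1) * x ^ (p - 1 - 1) * (t - x) := by
      have hc : ConvexOn ℝ (Ici 0) fun x : ℝ => x ^ (p - 1) := convexOn_rpow (by linarith)
      have h1 : HasDerivAt (fun x : ℝ => x ^ (p - 1)) ((p - 1) * x ^ (p - 1 - 1)) x :=
        Real.hasDerivAt_rpow_const (Or.inr (by linarith))
      have := hc.slope_le_of_hasDerivAt ht hx0.le hx h1
      rw [slope_def_field, div_le_iff₀ (by linarith)] at this
      linarith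
    have : h' x = p / 2 * (t ^ (p - 1) - (x ^ (p - 1) + (p - 1) * x ^ (p - 1 - 1) * (t - x))) := by
      simp only [h']; ring
    rw [this]
    exact mul_nonneg (by linarith) (by linarith)
  have hm : MonotoneOn h (Ici t) := by
    refine monotoneOn_of_deriv_nonneg (convex_Ici t)
      (fun x _ => (hd x).continuousAt.continuousWithinAt)
      (fun x _ => (hd x).differentiableAt.differentiableWithinAt) fun x hx => ?_
    rw [interior_Ici] at hx
    rw [(hd x).deriv]
    exact key x hx
  have := hm (mem_Ici.2 le_rfl) hts hts
  simp only [h, sub_self, mul_zero] at this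
  linarith

theorem rpow_sub_mul_sub_le {s t p : ℝ} (hs : 0 ≤ s) (ht : 0 ≤ t)
    (h : 1 ≤ p ∨ 0 < s ∧ 0 < t) :
    (s ^ p - t ^ p) * (s - t) ≤ max 1 (p / 2) * (s ^ (p - 1) + t ^ (p - 1)) * (s - t) ^ 2 := by
  wlog hts : t ≤ s generalizing s t
  · have := this ht hs (h.imp id And.symm) (le_of_not_ge hts)
    nlinarith
  have hnn : 0 ≤ (s ^ (p - 1) + t ^ (p - 1)) := by positivity
  have key : s ^ p - t ^ p ≤ max 1 (p / 2) * (s ^ (p - 1) + t ^ (p - 1)) * (s - t) := by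
    have hst : 0 ≤ s - t := by linarith
    rcases le_total p 2 with hp | hp
    · refine (rpow_sub_rpow_le_of_le_two ht hts hp (h.imp id And.right)).trans ?_
      gcongr
      exact le_mul_of_one_le_left hnn (le_max_left _ _)
    · refine (rpow_sub_rpow_le_of_two_le ht hts hp).trans ?_
      gcongr
      exact le_max_right _ _
  calc (s ^ p - t ^ p) * (s - t)
      ≤ max 1 (p / 2) * (s ^ (p - 1) + t ^ (p - 1)) * (s - t) * (s - t) :=
        mul_le_mul_of_nonneg_right key (by linarith)
    _ = _ := by ring

/-- Controls the tail l ≥ k, with δ = z - λᵢ and m = λ_l - λᵢ. -/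
theorem rpow_mul_le_rpow_sub_one_mul_sq {δ m p : ℝ} (hδ : 0 ≤ δ) (hm : δ ≤ m)
    (h : 1 ≤ p ∨ 0 < δ) : δ ^ p * m ≤ δ ^ (p - 1) * m ^ 2 := by
  rcases hδ.eq_or_lt with rfl | hδ0
  · have hp1 : 1 ≤ p := by simpa using h
    rw [Real.zero_rpow (by linarith), zero_mul]
    positivity
  · have e : δ ^ p = δ ^ (p - 1) * δ := by rw [← Real.rpow_add_one hδ0.ne']; ring_nf
    have : 0 ≤ δ ^ (p - 1) := by positivity
    rw [e, mul_assoc, sq]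
    have hm0 : 0 ≤ m := hδ.trans hm
    gcongr

/-- The commutator inequality for the sum rules of an abstract spectrum `lam`, `a` being the matrix
of a symmetric operator in a basis of eigenvectors. -/
theorem sum_rpow_mul_tsum_le {lam : ℕ → ℝ} {a : ℕ → ℕ → ℝ} (ha : ∀ i l, a i l = a l i) {k : ℕ}
    {z p : ℝ} (hlt : ∀ i < k, lam i ≤ z) (hge : ∀ l, k ≤ l → z ≤ lam l)
    (hp : 1 ≤ p ∨ ∀ i < k, lam i < z) {S T : ℕ → ℝ}
    (hS : ∀ i, HasSum (fun l => (lam l - lam i) * a i l ^ 2) (S i))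
    (hT : ∀ i, HasSum (fun l => (lam l - lam i) ^ 2 * a i l ^ 2) (T i)) :
    ∑ i ∈ Finset.range k, (z - lam i) ^ p * S i ≤
      max 1 (p / 2) * ∑ i ∈ Finset.range k, (z - lam i) ^ (p - 1) * T i := by
  set M := max 1 (p / 2) with hM
  have hM1 : 1 ≤ M := le_max_left _ _
  have hsum := hasSum_sum (s := Finset.range k) fun i _ =>
    ((hT i).mul_left (M * (z - lam i) ^ (p - 1))).sub ((hS i).mul_left ((z - lam i) ^ p))
  have hfin := hsum.summable.sum_add_tsum_nat_add k
  rw [hsum.tsum_eq] at hfin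
  have hnn : ∀ i < k, 0 ≤ z - lam i := fun i hi => by linarith [hlt i hi]
  have hpos : ∀ i < k, 1 ≤ p ∨ 0 < z - lam i := fun i hi =>
    hp.imp id fun h => by linarith [h i hi]
  -- For l ≥ k every single term is nonnegative.
  have h1 : 0 ≤ ∑' l, ∑ i ∈ Finset.range k,
      (M * (z - lam i) ^ (p - 1) * ((lam (l + k) - lam i) ^ 2 * a i (l + k) ^ 2) -
        (z - lam i) ^ p * ((lam (l + k) - lam i) * a i (l + k) ^ 2)) := by
    refine tsum_nonneg fun l => Finset.sum_nonneg fun i hi => ?_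
    rw [Finset.mem_range] at hi
    have hz := hge (l + k) (Nat.le_add_left _ _)
    have h := rpow_mul_le_rpow_sub_one_mul_sq (p := p) (hnn i hi)
      (show z - lam i ≤ lam (l + k) - lam i by linarith) (hpos i hi)
    have h0 : 0 ≤ (z - lam i) ^ (p - 1) * (lam (l + k) - lam i) ^ 2 :=
      mul_nonneg (Real.rpow_nonneg (hnn i hi) _) (sq_nonneg _)
    have h2 : (z - lam i) ^ p * (lam (l + k) - lam i) ≤
        M * ((z - lam i) ^ (p - 1) * (lam (l + k) - lam i) ^ 2) :=
      h.trans (le_mul_of_one_le_left h0 hM1)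
    nlinarith [mul_le_mul_of_nonneg_right h2 (sq_nonneg (a i (l + k)))]
  have h2 : 0 ≤ ∑ l ∈ Finset.range k, ∑ i ∈ Finset.range k,
      (M * (z - lam i) ^ (p - 1) * ((lam l - lam i) ^ 2 * a i l ^ 2) -
        (z - lam i) ^ p * ((lam l - lam i) * a i l ^ 2)) := by
    set F : ℕ → ℕ → ℝ := fun l i => M * (z - lam i) ^ (p - 1) * ((lam l - lam i) ^ 2 * a i l ^ 2) -
        (z - lam i) ^ p * ((lam l - lam i) * a i l ^ 2) with hF
    -- In the block i, l < k single terms may be negative. Symmetry of a allows pairing (i, l) with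
    -- (l, i), and each pair is `rpow_sub_mul_sub_le` with s = z - λᵢ, t = z - λ_l.
    have hsymm : 2 * ∑ l ∈ Finset.range k, ∑ i ∈ Finset.range k, F l i =
        ∑ l ∈ Finset.range k, ∑ i ∈ Finset.range k, (F l i + F i l) := by
      simp_rw [Finset.sum_add_distrib]
      rw [two_mul]
      congr 1
      exact Finset.sum_comm
    have : 0 ≤ ∑ l ∈ Finset.range k, ∑ i ∈ Finset.range k, (F l i + F i l) := by
      refine Finset.sum_nonneg fun l hl => Finset.sum_nonneg fun i hi => ?_
      rw [Finset.mem_range] at hi hl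
      have h := rpow_sub_mul_sub_le (p := p) (hnn i hi) (hnn l hl)
        (by rcases hp with h | h
            · exact Or.inl h
            · exact Or.inr ⟨by linarith [h i hi], by linarith [h l hl]⟩)
      have h3 := mul_le_mul_of_nonneg_right h (sq_nonneg (a i l))
      simp only [hF, ha l i]
      nlinarith
    linarith
  have h3 : ∑ i ∈ Finset.range k, (M * (z - lam i) ^ (p - 1) * T i - (z - lam i) ^ p * S i) =
      M * ∑ i ∈ Finset.range k, (z - lam i) ^ (p - 1) * T i -
        ∑ i ∈ Finset.range k, (z - lam i) ^ p * S i := by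
    rw [Finset.sum_sub_distrib, Finset.mul_sum]
    simp_rw [mul_assoc]
  linarith

/-! ### Riesz means and the Weyl type bound -/

/-- Passing from Yang's inequality for all `z` to a Weyl type bound, by monotonicity of the
Riesz mean `∑ (z - lam i)₊ ^ 2` divided by `z ^ (2 + d / 2)`. -/
theorem le_rpow_mul_of_yang {lam : ℕ → ℝ} (hmono : Monotone lam) (h0 : 0 < lam 0) {d : ℝ}
    (hd : 0 < d)
    (hyang : ∀ (k : ℕ) (z : ℝ), (∀ i < k, lam i ≤ z) → (∀ l, k ≤ l → z ≤ lam l) →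
      ∑ i ∈ Finset.range k, (z - lam i) ^ 2 ≤
        4 / d * ∑ i ∈ Finset.range k, (z - lam i) * lam i) {k : ℕ} (hk : 1 ≤ k) :
    lam k ≤ (1 + 4 / d) * (k : ℝ) ^ (2 / d) * lam 0 := by
  have hk1 : (1 : ℝ) ≤ k := by exact_mod_cast hk
  have hkd : (1 : ℝ) ≤ (k : ℝ) ^ (2 / d) := Real.one_le_rpow hk1 (by positivity)
  set c := 4 / d with hc
  have hc0 : 0 < c := by positivity
  -- The maximum point of (z - λ)² z^(-2-d/2) on z ≥ λ, for λ = `lam 0`: the best place to keep only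
  -- the first term of the Riesz mean.
  set z0 := (1 + c) * lam 0 with hz0
  have hz00 : 0 < z0 := by positivity
  rcases le_or_gt (lam k) z0 with hle | hlt
  · refine hle.trans ?_
    rw [hz0]
    nlinarith
  -- Chosen so that αc = 2(1 + c); Yang's inequality then reads z R' ≥ α R, so R z^(-α) is
  -- nondecreasing.
  set α := 2 + d / 2 with hα
  have hαc : α * c = 2 * (1 + c) := by
    rw [hα, hc]; field_simp; ring
  let R : ℝ → ℝ := fun z => ∑ i ∈ Finset.range k, (max (z - lam i) 0) ^ 2
  let R1 : ℝ → ℝ := fun z => ∑ i ∈ Finset.range k, max (z - lam i) 0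
  have hR : ∀ z, HasDerivAt R (2 * R1 z) z := fun z => by
    have h1 : ∀ x : ℝ, HasDerivAt (fun x : ℝ => (max x 0) ^ 2) (2 * max x 0) x := fun x => by
      rcases lt_trichotomy x 0 with hx | rfl | hx
      · rw [max_eq_right hx.le, mul_zero]
        refine (hasDerivAt_const x (0 : ℝ)).congr_of_eventuallyEq ?_
        filter_upwards [Iio_mem_nhds hx] with y hy
        rw [max_eq_right (le_of_lt hy)]; simp
      · rw [hasDerivAt_iff_isLittleO_nhds_zero]
        simp only [zero_add, max_self, mul_zero, smul_zero, sub_zero]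
        have h2 : (fun x : ℝ => (max x 0) ^ 2) =O[𝓝 0] fun x : ℝ => x ^ 2 := by
          refine Asymptotics.IsBigO.of_bound 1 (Eventually.of_forall fun y => ?_)
          rw [one_mul, Real.norm_of_nonneg (sq_nonneg _), Real.norm_of_nonneg (sq_nonneg _)]
          rcases le_total y 0 with hy | hy
          · rw [max_eq_right hy]; nlinarith [sq_nonneg y]
          · rw [max_eq_left hy]
        have h3 : (fun x : ℝ => x ^ 2) =o[𝓝 0] fun x : ℝ => x := by
          simpa using Asymptotics.isLittleO_pow_id (𝕜 := ℝ) (n := 2) (by norm_num)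
        simpa using h2.trans_isLittleO h3
      · rw [max_eq_left hx.le]
        have := hasDerivAt_pow 2 x
        simp only [Nat.cast_ofNat, Nat.add_one_sub_one, pow_one] at this
        refine this.congr_of_eventuallyEq ?_
        filter_upwards [Ioi_mem_nhds hx] with y hy
        rw [max_eq_left (le_of_lt hy)]
    simp only [R, R1, Finset.mul_sum]
    exact HasDerivAt.fun_sum fun i _ => by
      have := (h1 (z - lam i)).comp z ((hasDerivAt_id z).sub_const (lam i))
      rwa [mul_one] at this
  -- Yang's inequality at z involves the first m eigenvalues, those below z. As z ≤ `lam k`, m ≤ k,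
  -- and the remaining positive parts vanish.
  have hRR1 : ∀ z ≤ lam k, (1 + c) * R z ≤ c * (z * R1 z) := fun z hz => by
    have hex : ∃ m, z ≤ lam m := ⟨k, hz⟩
    classical
    set m := Nat.find hex with hm
    have hmk : m ≤ k := Nat.find_min' hex hz
    have hlt : ∀ i < m, lam i ≤ z := fun i hi => (not_le.1 (Nat.find_min hex hi)).le
    have hge : ∀ l, m ≤ l → z ≤ lam l := fun l hl => (Nat.find_spec hex).trans (hmono hl)
    have hsub : Finset.range m ⊆ Finset.range k := Finset.range_subset_range.2 hmk
    have e1 : R z = ∑ i ∈ Finset.range m, (z - lam i) ^ 2 := by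
      refine (Finset.sum_subset_zero_on_sdiff hsub (fun i hi => ?_) fun i hi => ?_).symm
      · simp only [Finset.mem_sdiff, Finset.mem_range, not_lt] at hi
        rw [max_eq_right (by linarith [hge i hi.2])]; simp
      · rw [max_eq_left (by linarith [hlt i (Finset.mem_range.1 hi)])]
    have e2 : R1 z = ∑ i ∈ Finset.range m, (z - lam i) := by
      refine (Finset.sum_subset_zero_on_sdiff hsub (fun i hi => ?_) fun i hi => ?_).symm
      · simp only [Finset.mem_sdiff, Finset.mem_range, not_lt] at hi
        rw [max_eq_right (by linarith [hge i hi.2])]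
      · rw [max_eq_left (by linarith [hlt i (Finset.mem_range.1 hi)])]
    have h := hyang m z hlt hge
    have e3 : ∑ i ∈ Finset.range m, (z - lam i) * lam i = z * R1 z - R z := by
      rw [e1, e2, Finset.mul_sum, ← Finset.sum_sub_distrib]
      exact Finset.sum_congr rfl fun i _ => by ring
    rw [e3, ← e1] at h
    linarith
  let Q : ℝ → ℝ := fun z => R z * z ^ (-α)
  have hQ : ∀ z, 0 < z → HasDerivAt Q (2 * R1 z * z ^ (-α) + R z * (-α * z ^ (-α - 1))) z :=
    fun z hz => (hR z).mul (Real.hasDerivAt_rpow_const (Or.inl hz.ne'))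
  have hQm : MonotoneOn Q (Icc z0 (lam k)) := by
    refine monotoneOn_of_deriv_nonneg (convex_Icc _ _)
      (fun x hx => (hQ x (hz00.trans_le hx.1)).continuousAt.continuousWithinAt)
      (fun x hx => ?_) fun x hx => ?_
    · rw [interior_Icc] at hx
      exact (hQ x (hz00.trans hx.1)).differentiableAt.differentiableWithinAt
    · rw [interior_Icc] at hx
      have hx0 := hz00.trans hx.1
      rw [(hQ x hx0).deriv]
      have e : x ^ (-α) = x ^ (-α - 1) * x := by rw [← Real.rpow_add_one hx0.ne']; ring_nf
      have h1 := hRR1 x hx.2.le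
      have h2 : 0 ≤ c * (2 * (x * R1 x) - α * R x) := by
        have e2 : c * (2 * (x * R1 x) - α * R x) = 2 * (c * (x * R1 x)) - α * c * R x := by ring
        rw [e2, hαc]
        linarith
      have h3 : 0 ≤ 2 * (x * R1 x) - α * R x := nonneg_of_mul_nonneg_right h2 hc0
      have h4 : 0 ≤ x ^ (-α - 1) := by positivity
      rw [e]
      nlinarith [mul_nonneg h4 h3]
  have hmain : R z0 * z0 ^ (-α) ≤ R (lam k) * (lam k) ^ (-α) :=
    hQm ⟨le_rfl, hlt.le⟩ ⟨hlt.le, le_rfl⟩ hlt.le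
  set Z := lam k with hZ
  have hZ0 : 0 < Z := hz00.trans hlt
  have hlow : (c * lam 0) ^ 2 ≤ R z0 := by
    have : (max (z0 - lam 0) 0) ^ 2 ≤ R z0 :=
      Finset.single_le_sum (f := fun i => (max (z0 - lam i) 0) ^ 2) (fun i _ => sq_nonneg _)
        (Finset.mem_range.2 hk)
    have e : z0 - lam 0 = c * lam 0 := by rw [hz0]; ring
    rwa [e, max_eq_left (by positivity)] at this
  have hcs : R1 Z ^ 2 ≤ k * R Z := by
    have := sq_sum_le_card_mul_sum_sq (s := Finset.range k) (f := fun i => max (Z - lam i) 0)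
    simpa [R, R1] using this
  have hRn : 0 ≤ R Z := Finset.sum_nonneg fun i _ => sq_nonneg _
  -- Yang bounds R by R1, and Cauchy–Schwarz bounds R1² by kR; one factor R cancels.
  have hup : (1 + c) ^ 2 * R Z ≤ k * (c * Z) ^ 2 := by
    rcases hRn.eq_or_lt with h | h
    · rw [← h, mul_zero]; positivity
    · have h1 := hRR1 Z le_rfl
      have h2 : ((1 + c) * R Z) ^ 2 ≤ (c * (Z * R1 Z)) ^ 2 :=
        pow_le_pow_left₀ (by positivity) h1 2
      have h3 : (c * Z) ^ 2 * R1 Z ^ 2 ≤ (c * Z) ^ 2 * (k * R Z) :=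
        mul_le_mul_of_nonneg_left hcs (sq_nonneg _)
      have h4 : ((1 + c) ^ 2 * R Z) * R Z ≤ (k * (c * Z) ^ 2) * R Z := by nlinarith
      exact le_of_mul_le_mul_right h4 h
  have hz0pow : z0 ^ (-α) = z0 ^ (-(d / 2)) / z0 ^ 2 := by
    rw [← Real.rpow_sub_natCast hz00.ne', hα]
    congr 1
    push_cast
    ring
  have hZpow : Z ^ (-α) = Z ^ (-(d / 2)) / Z ^ 2 := by
    rw [← Real.rpow_sub_natCast hZ0.ne', hα]
    congr 1
    push_cast
    ring
  -- Inserting both bounds in the monotonicity from z0 to Z, the factors c² and (1 + c)² cancel.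
  have hfin : z0 ^ (-(d / 2)) ≤ k * Z ^ (-(d / 2)) := by
    have p1 : 0 < z0 ^ (-(d / 2)) := by positivity
    have p2 : 0 < Z ^ (-(d / 2)) := by positivity
    have h1 : c ^ 2 * z0 ^ (-(d / 2)) ≤ (1 + c) ^ 2 * (R z0 * z0 ^ (-α)) := by
      rw [hz0pow]
      have : (1 + c) ^ 2 * (R z0 * (z0 ^ (-(d / 2)) / z0 ^ 2)) =
          R z0 / lam 0 ^ 2 * z0 ^ (-(d / 2)) := by
        nth_rewrite 3 [hz0]
        field_simp
      rw [this]
      refine mul_le_mul_of_nonneg_right ?_ p1.le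
      rw [le_div_iff₀ (by positivity)]
      linarith
    have h2 : (1 + c) ^ 2 * (R Z * Z ^ (-α)) ≤ c ^ 2 * (k * Z ^ (-(d / 2))) := by
      rw [hZpow]
      have : (1 + c) ^ 2 * (R Z * (Z ^ (-(d / 2)) / Z ^ 2)) =
          ((1 + c) ^ 2 * R Z) / Z ^ 2 * Z ^ (-(d / 2)) := by ring
      rw [this, ← mul_assoc]
      refine mul_le_mul_of_nonneg_right ?_ p2.le
      rw [div_le_iff₀ (by positivity)]
      linarith
    have h3 := mul_le_mul_of_nonneg_left hmain (by positivity : 0 ≤ (1 + c) ^ 2)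
    exact le_of_mul_le_mul_left (h1.trans (h3.trans h2)) (by positivity)
  have hfin2 : Z ^ (d / 2) ≤ k * z0 ^ (d / 2) := by
    rw [Real.rpow_neg hz00.le, Real.rpow_neg hZ0.le, ← div_eq_mul_inv,
      le_div_iff₀ (by positivity), inv_mul_le_iff₀ (by positivity)] at hfin
    linarith
  have hfin3 := Real.rpow_le_rpow (by positivity) hfin2 (by positivity : 0 ≤ 2 / d)
  have e : d / 2 * (2 / d) = 1 := by field_simp
  rw [Real.mul_rpow (by positivity) (by positivity), ← Real.rpow_mul hZ0.le,
    ← Real.rpow_mul hz00.le, e, Real.rpow_one, Real.rpow_one] at hfin3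
  rw [hz0] at hfin3
  linarith

/-! ### Left invariant forms in a chart and their local primitives -/

theorem ofNat_two_le_infty : (2 : WithTop ℕ∞) ≤ ∞ :=
  WithTop.coe_le_coe.2 (le_top : (2 : ℕ∞) ≤ ⊤)

theorem ofNat_three_le_infty : (3 : WithTop ℕ∞) ≤ ∞ :=
  WithTop.coe_le_coe.2 (le_top : (3 : ℕ∞) ≤ ⊤)

section LocalPrimitive

variable {n : ℕ} {G : Type*} [TopologicalSpace G] [ChartedSpace (EuclideanSpace ℝ (Fin n)) G]
  [Group G] [LieGroup (𝓡 n) ∞ G]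

theorem mdifferentiable_const_mul (g : G) : MDifferentiable (𝓡 n) (𝓡 n) fun h : G => g * h :=
  (contMDiff_mul_left (n := ∞)).mdifferentiable (by simp)

theorem mfderiv_mulInvariantVectorField {F : Type*} [NormedAddCommGroup F] [NormedSpace ℝ F]
    {φ : G → F} {g : G} (v : LieAlg n G) (hφ : MDifferentiableAt (𝓡 n) 𝓘(ℝ, F) φ g) :
    (mfderiv (𝓡 n) 𝓘(ℝ, F) φ g (mulInvariantVectorField v g) : F) =
      mfderiv (𝓡 n) 𝓘(ℝ, F) (fun x => φ (g * x)) 1 v := by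
  have h2 : MDifferentiableAt (𝓡 n) 𝓘(ℝ, F) φ (g * 1) := by rwa [mul_one]
  have h3 := mfderiv_comp (1 : G) h2 (mdifferentiable_const_mul g 1)
  have key : ∀ g', g' = g → (mfderiv (𝓡 n) 𝓘(ℝ, F) φ g' : EuclideanSpace ℝ (Fin n) →L[ℝ] F) =
      mfderiv (𝓡 n) 𝓘(ℝ, F) φ g := by
    rintro _ rfl; rfl
  have h4 : (mfderiv (𝓡 n) 𝓘(ℝ, F) (fun x => φ (g * x)) 1 : EuclideanSpace ℝ (Fin n) →L[ℝ] F) =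
      (mfderiv (𝓡 n) 𝓘(ℝ, F) φ (g * 1) : EuclideanSpace ℝ (Fin n) →L[ℝ] F).comp
      (mfderiv (𝓡 n) (𝓡 n) (fun x => g * x) 1) := h3
  rw [key _ (mul_one g)] at h4
  exact (congrArg (fun L : EuclideanSpace ℝ (Fin n) →L[ℝ] F => L v) h4).symm

/-- The invariant derivative commutes with left translations. -/
theorem invariantDeriv_comp_mul_left {φ : G → ℝ} {g h : G} (v : LieAlg n G)
    (hφ : MDifferentiableAt (𝓡 n) 𝓘(ℝ, ℝ) φ (g * h)) :
    invariantDeriv v (fun x => φ (g * x)) h = invariantDeriv v φ (g * h) := by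
  have h1 : MDifferentiableAt (𝓡 n) 𝓘(ℝ, ℝ) (fun x => φ (g * x)) h :=
    MDifferentiableAt.comp h hφ (mdifferentiable_const_mul g h)
  refine (mfderiv_mulInvariantVectorField v h1).trans
    (Eq.trans ?_ (mfderiv_mulInvariantVectorField v hφ).symm)
  have key : ∀ F F' : G → ℝ, F = F' →
      (mfderiv (𝓡 n) 𝓘(ℝ, ℝ) F 1 v : ℝ) = mfderiv (𝓡 n) 𝓘(ℝ, ℝ) F' 1 v := by
    rintro _ _ rfl; rfl
  exact key _ _ (funext fun x => by simp only [mul_assoc])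

/-- The left invariant form with value `ℓ` at the identity, in the chart at the identity. -/
noncomputable def invariantFormInChart (G : Type*) [TopologicalSpace G]
    [ChartedSpace (EuclideanSpace ℝ (Fin n)) G] [Group G]
    (ℓ : EuclideanSpace ℝ (Fin n) →L[ℝ] ℝ) (x : EuclideanSpace ℝ (Fin n)) :
    EuclideanSpace ℝ (Fin n) →L[ℝ] ℝ :=
  ℓ.comp (fderiv ℝ (fun y => (extChartAt (𝓡 n) (1 : G))
    (((extChartAt (𝓡 n) (1 : G)).symm x)⁻¹ * (extChartAt (𝓡 n) (1 : G)).symm y)) x)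

theorem contMDiffAt_extChartAt_one_symm {x : EuclideanSpace ℝ (Fin n)}
    (hx : x ∈ (extChartAt (𝓡 n) (1 : G)).target) :
    ContMDiffAt 𝓘(ℝ, EuclideanSpace ℝ (Fin n)) (𝓡 n) ∞ (extChartAt (𝓡 n) (1 : G)).symm x := by
  exact (contMDiffOn_extChartAt_symm (1 : G)).contMDiffAt
    ((isOpen_extChartAt_target (1 : G)).mem_nhds hx)

/-- The form is a partial derivative, taken on the diagonal, of the jointly smooth map (x, y) ↦ x⁻¹y
read in the chart. -/
theorem contDiffAt_invariantFormInChart (ℓ : EuclideanSpace ℝ (Fin n) →L[ℝ] ℝ)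
    {x : EuclideanSpace ℝ (Fin n)} (hx : x ∈ (extChartAt (𝓡 n) (1 : G)).target) :
    ContDiffAt ℝ ∞ (invariantFormInChart G ℓ) x := by
  let E := EuclideanSpace ℝ (Fin n)
  let H : E → E → E := fun x y => (extChartAt (𝓡 n) (1 : G))
    (((extChartAt (𝓡 n) (1 : G)).symm x)⁻¹ * (extChartAt (𝓡 n) (1 : G)).symm y)
  have hs := contMDiffAt_extChartAt_one_symm hx
  have h1 : ContMDiffAt 𝓘(ℝ, E × E) (𝓡 n) ∞
      (fun q : E × E => (extChartAt (𝓡 n) (1 : G)).symm q.1) (x, x) :=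
    ContMDiffAt.comp (x, x) hs contDiff_fst.contMDiff.contMDiffAt
  have h2 : ContMDiffAt 𝓘(ℝ, E × E) (𝓡 n) ∞
      (fun q : E × E => (extChartAt (𝓡 n) (1 : G)).symm q.2) (x, x) :=
    ContMDiffAt.comp (x, x) hs contDiff_snd.contMDiff.contMDiffAt
  have h3 : ContMDiffAt 𝓘(ℝ, E × E) (𝓡 n) ∞ (fun q : E × E =>
      ((extChartAt (𝓡 n) (1 : G)).symm q.1)⁻¹ * (extChartAt (𝓡 n) (1 : G)).symm q.2) (x, x) :=
    (h1.inv).mul h2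
  have h4 : ContMDiffAt (𝓡 n) 𝓘(ℝ, E) ∞ (extChartAt (𝓡 n) (1 : G))
      (((extChartAt (𝓡 n) (1 : G)).symm x)⁻¹ * (extChartAt (𝓡 n) (1 : G)).symm x) := by
    rw [inv_mul_cancel]
    exact contMDiffAt_extChartAt
  have h5 : ContDiffAt ℝ ∞ (Function.uncurry H) (x, x) :=
    (ContMDiffAt.comp (x, x) h4 h3).contDiffAt
  have h6 : ContDiffAt ℝ ∞ (fun x => fderiv ℝ (H x) x) x :=
    ContDiffAt.fderiv (m := ∞) h5 contDiffAt_id (by simp)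
  exact contDiffAt_const.clm_comp h6

/-- A left invariant vector field in the chart at the identity. -/
noncomputable def invariantFieldInChart (v : LieAlg n G) (x : EuclideanSpace ℝ (Fin n)) :
    EuclideanSpace ℝ (Fin n) :=
  VectorField.mpullback 𝓘(ℝ, EuclideanSpace ℝ (Fin n)) (𝓡 n) (extChartAt (𝓡 n) (1 : G)).symm
    (mulInvariantVectorField v) x

theorem isInvertible_mfderiv_extChartAt_one_symm {x : EuclideanSpace ℝ (Fin n)}
    (hx : x ∈ (extChartAt (𝓡 n) (1 : G)).target) :
    (mfderiv 𝓘(ℝ, EuclideanSpace ℝ (Fin n)) (𝓡 n)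
      (extChartAt (𝓡 n) (1 : G)).symm x).IsInvertible := by
  have : IsManifold (𝓡 n) 1 G := .of_le (n := ∞) (by simp)
  have := isInvertible_mfderivWithin_extChartAt_symm (I := 𝓡 n) hx
  simpa using this

/-- This derivative is the Maurer–Cartan form in the chart: it sends a left invariant field to its
value at the identity. -/
theorem fderiv_chart_invariantFieldInChart (v : LieAlg n G)
    {x : EuclideanSpace ℝ (Fin n)} (hx : x ∈ (extChartAt (𝓡 n) (1 : G)).target) :
    fderiv ℝ (fun y => (extChartAt (𝓡 n) (1 : G))
    (((extChartAt (𝓡 n) (1 : G)).symm x)⁻¹ * (extChartAt (𝓡 n) (1 : G)).symm y)) x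
      (invariantFieldInChart v x) = v := by
  have : IsManifold (𝓡 n) 1 G := .of_le (n := ∞) (by simp)
  let E := EuclideanSpace ℝ (Fin n)
  set g := (extChartAt (𝓡 n) (1 : G)).symm x with hg
  let φ : G → E := fun h => extChartAt (𝓡 n) (1 : G) (g⁻¹ * h)
  have hψ : MDifferentiableAt (𝓡 n) 𝓘(ℝ, E) (extChartAt (𝓡 n) (1 : G)) (g⁻¹ * g) := by
    rw [inv_mul_cancel]
    exact mdifferentiableAt_extChartAt (mem_chart_source _ _)
  have hφ : MDifferentiableAt (𝓡 n) 𝓘(ℝ, E) φ g :=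
    MDifferentiableAt.comp g hψ (mdifferentiable_const_mul g⁻¹ g)
  have hs : MDifferentiableAt 𝓘(ℝ, E) (𝓡 n) (extChartAt (𝓡 n) (1 : G)).symm x :=
    (contMDiffAt_extChartAt_one_symm hx).mdifferentiableAt (by simp)
  have e1 : fderiv ℝ (fun y => (extChartAt (𝓡 n) (1 : G))
      (g⁻¹ * (extChartAt (𝓡 n) (1 : G)).symm y)) x =
      (mfderiv (𝓡 n) 𝓘(ℝ, E) φ g : E →L[ℝ] E).comp
        (mfderiv 𝓘(ℝ, E) (𝓡 n) (extChartAt (𝓡 n) (1 : G)).symm x) := by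
    rw [← mfderiv_eq_fderiv]
    exact mfderiv_comp x (I' := 𝓡 n) hφ hs
  have e2 : (mfderiv 𝓘(ℝ, E) (𝓡 n) (extChartAt (𝓡 n) (1 : G)).symm x)
      (invariantFieldInChart v x) = mulInvariantVectorField v g :=
    (isInvertible_mfderiv_extChartAt_one_symm hx).self_apply_inverse _
  refine (congrArg (fun L : E →L[ℝ] E => L (invariantFieldInChart v x)) e1).trans ?_
  refine (congrArg (mfderiv (𝓡 n) 𝓘(ℝ, E) φ g : E →L[ℝ] E) e2).trans
    ((mfderiv_mulInvariantVectorField v hφ).trans ?_)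
  have e3 : (fun h => φ (g * h)) = extChartAt (𝓡 n) (1 : G) := by
    ext1 h; simp [φ]
  rw [e3, mfderiv_extChartAt_self]
  rfl

/-- A one-sided inverse in finite dimension is two-sided; hence left invariant fields span every
tangent space. -/
theorem invariantFieldInChart_fderiv_chart (a : EuclideanSpace ℝ (Fin n))
    {x : EuclideanSpace ℝ (Fin n)} (hx : x ∈ (extChartAt (𝓡 n) (1 : G)).target) :
    invariantFieldInChart (G := G) (fderiv ℝ (fun y => (extChartAt (𝓡 n) (1 : G))
    (((extChartAt (𝓡 n) (1 : G)).symm x)⁻¹ * (extChartAt (𝓡 n) (1 : G)).symm y)) x a) x = a := by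
  let E := EuclideanSpace ℝ (Fin n)
  let B : E →L[ℝ] E := (mfderiv 𝓘(ℝ, E) (𝓡 n) (extChartAt (𝓡 n) (1 : G)).symm x).inverse.comp
    (mfderiv (𝓡 n) (𝓡 n) (fun h => (extChartAt (𝓡 n) (1 : G)).symm x * h) (1 : G))
  let A : E →L[ℝ] E := fderiv ℝ (fun y => (extChartAt (𝓡 n) (1 : G))
    (((extChartAt (𝓡 n) (1 : G)).symm x)⁻¹ * (extChartAt (𝓡 n) (1 : G)).symm y)) x
  have hAB : (A : E →ₗ[ℝ] E) * (B : E →ₗ[ℝ] E) = 1 :=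
    LinearMap.ext fun v => fderiv_chart_invariantFieldInChart v hx
  exact LinearMap.congr_fun (mul_eq_one_comm.1 hAB) a

theorem differentiableAt_invariantFieldInChart (v : LieAlg n G)
    {x : EuclideanSpace ℝ (Fin n)} (hx : x ∈ (extChartAt (𝓡 n) (1 : G)).target) :
    DifferentiableAt ℝ (invariantFieldInChart v) x := by
  have : LieGroup (𝓡 n) (minSmoothness ℝ 3) G :=
    .of_le (n := ∞) (by simpa using ofNat_three_le_infty)
  have : LieGroup (𝓡 n) (minSmoothness ℝ 2) G :=
    .of_le (n := ∞) (by simpa using ofNat_two_le_infty)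
  have : IsManifold (𝓡 n) 2 G := .of_le (n := ∞) ofNat_two_le_infty
  have : IsManifold (𝓡 n) 1 G := .of_le (n := ∞) (by simp)
  have h1 := contMDiffAt_mulInvariantVectorField v
    (g := (extChartAt (𝓡 n) (1 : G)).symm x)
  have h2 := ContMDiffAt.mpullback_vectorField_preimage (m := 1) (n := ∞) (h1.of_le (by simp))
    (contMDiffAt_extChartAt_one_symm hx) (isInvertible_mfderiv_extChartAt_one_symm hx) (by
      rw [one_add_one_eq_two]; exact ofNat_two_le_infty)
  exact (contMDiffAt_vectorSpace_iff_contDiffAt.1 h2).differentiableAt (by simp)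

theorem lieBracket_invariantFieldInChart (v w : LieAlg n G)
    {x : EuclideanSpace ℝ (Fin n)} (hx : x ∈ (extChartAt (𝓡 n) (1 : G)).target) :
    VectorField.lieBracket ℝ (invariantFieldInChart v) (invariantFieldInChart w) x =
      invariantFieldInChart ⁅v, w⁆ x := by
  have : LieGroup (𝓡 n) (minSmoothness ℝ 3) G :=
    .of_le (n := ∞) (by simpa using ofNat_three_le_infty)
  have : IsManifold (𝓡 n) (minSmoothness ℝ 3) G :=
    .of_le (n := ∞) (by simpa using ofNat_three_le_infty)
  have : IsManifold (𝓡 n) (minSmoothness ℝ 2) G :=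
    .of_le (n := ∞) (by simpa using ofNat_two_le_infty)
  rw [invariantFieldInChart, GroupLieAlgebra.bracket_def, mulInvariantVector_mlieBracket,
    VectorField.mpullback_mlieBracket (n := ∞) (mdifferentiableAt_mulInvariantVectorField v)
      (mdifferentiableAt_mulInvariantVectorField w) (contMDiffAt_extChartAt_one_symm hx)
      (by simpa using ofNat_two_le_infty),
    ← VectorField.mlieBracketWithin_univ, VectorField.mlieBracketWithin_eq_lieBracketWithin]
  exact (congrFun VectorField.lieBracketWithin_univ x).symm

/-- Closedness by the Maurer–Cartan equation. Differentiating the constants ω(X_v) and ω(X_w) gives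
dω(X_v, X_w) = -ω([X_v, X_w]) = -ℓ([v, w]) = 0, and any a, b are values of such fields at x. -/
theorem fderiv_invariantFormInChart_symm {ℓ : EuclideanSpace ℝ (Fin n) →L[ℝ] ℝ}
    (hℓ : ∀ v w : LieAlg n G, ℓ (⁅v, w⁆ : LieAlg n G) = 0)
    {x : EuclideanSpace ℝ (Fin n)} (hx : x ∈ (extChartAt (𝓡 n) (1 : G)).target)
    (a b : EuclideanSpace ℝ (Fin n)) :
    fderiv ℝ (invariantFormInChart G ℓ) x a b = fderiv ℝ (invariantFormInChart G ℓ) x b a := by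
  have hω : DifferentiableAt ℝ (invariantFormInChart G ℓ) x :=
    (contDiffAt_invariantFormInChart ℓ hx).differentiableAt (by simp)
  have hval : ∀ v : LieAlg n G, ∀ y ∈ (extChartAt (𝓡 n) (1 : G)).target,
      invariantFormInChart G ℓ y (invariantFieldInChart v y) = ℓ v := fun v y hy =>
    congrArg ℓ (fderiv_chart_invariantFieldInChart v hy)
  have hder : ∀ (v : LieAlg n G) (c : EuclideanSpace ℝ (Fin n)),
      fderiv ℝ (invariantFormInChart G ℓ) x c (invariantFieldInChart v x) =
        - invariantFormInChart G ℓ x (fderiv ℝ (invariantFieldInChart v) x c) := fun v c => by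
    have h1 := hω.hasFDerivAt.clm_apply (differentiableAt_invariantFieldInChart v hx).hasFDerivAt
    have h2 : (fun y => invariantFormInChart G ℓ y (invariantFieldInChart v y)) =ᶠ[𝓝 x]
        fun _ => ℓ v := by
      filter_upwards [(isOpen_extChartAt_target (1 : G)).mem_nhds hx] with y hy
      exact hval v y hy
    have h3 := (h1.congr_of_eventuallyEq h2.symm).unique (hasFDerivAt_const (ℓ v) x)
    have h4 := congrArg (fun L : EuclideanSpace ℝ (Fin n) →L[ℝ] ℝ => L c) h3
    simp at h4
    linarith
  have ha := invariantFieldInChart_fderiv_chart a hx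
  have hb := invariantFieldInChart_fderiv_chart b hx
  set v : LieAlg n G := fderiv ℝ (fun y => (extChartAt (𝓡 n) (1 : G))
    (((extChartAt (𝓡 n) (1 : G)).symm x)⁻¹ * (extChartAt (𝓡 n) (1 : G)).symm y)) x a
  set w : LieAlg n G := fderiv ℝ (fun y => (extChartAt (𝓡 n) (1 : G))
    (((extChartAt (𝓡 n) (1 : G)).symm x)⁻¹ * (extChartAt (𝓡 n) (1 : G)).symm y)) x b
  have h1 := hder w a
  have h2 := hder v b
  have h3 := lieBracket_invariantFieldInChart v w hx
  have h4 := hval ⁅v, w⁆ x hx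
  rw [← h3, VectorField.lieBracket, ha, hb, map_sub, hℓ] at h4
  rw [hb] at h1
  rw [ha] at h2
  rw [h1, h2]
  linarith

/-- A left invariant form that vanishes on brackets has a primitive near the identity. -/
theorem exists_local_primitive {ℓ : EuclideanSpace ℝ (Fin n) →L[ℝ] ℝ}
    (hℓ : ∀ v w : LieAlg n G, ℓ (⁅v, w⁆ : LieAlg n G) = 0) :
    ∃ (U : Set G) (F : G → ℝ), IsOpen U ∧ 1 ∈ U ∧ ContMDiffOn (𝓡 n) 𝓘(ℝ, ℝ) ∞ F U ∧
      ∀ g ∈ U, ∀ v : LieAlg n G, invariantDeriv v F g = ℓ v := by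
  let E := EuclideanSpace ℝ (Fin n)
  have hopen := isOpen_extChartAt_target (I := 𝓡 n) (1 : G)
  obtain ⟨r, hr, hball⟩ := Metric.isOpen_iff.1 hopen _ (mem_extChartAt_target (I := 𝓡 n) (1 : G))
  set B := Metric.ball (extChartAt (𝓡 n) (1 : G) 1) r with hB
  have hsm : ContDiffOn ℝ ∞ (invariantFormInChart G ℓ) B := fun x hx =>
    (contDiffAt_invariantFormInChart ℓ (hball hx)).contDiffWithinAt
  -- Poincaré lemma on a ball; φ is then smooth because its derivative is.
  obtain ⟨φ, hφ⟩ := (convex_ball _ r).exists_forall_hasFDerivAt_of_fderiv_symmetric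
    (𝕜 := ℝ) Metric.isOpen_ball
    (hsm.differentiableOn (by simp))
    (fun x hx a b => fderiv_invariantFormInChart_symm hℓ (hball hx) a b)
  have hφs : ContDiffOn ℝ ∞ φ B := by
    rw [contDiffOn_infty_iff_fderiv_of_isOpen Metric.isOpen_ball]
    exact ⟨fun x hx => (hφ x hx).differentiableAt.differentiableWithinAt,
      hsm.congr fun x hx => (hφ x hx).fderiv⟩
  refine ⟨(extChartAt (𝓡 n) (1 : G)).source ∩ extChartAt (𝓡 n) (1 : G) ⁻¹' B,
    fun g => φ (extChartAt (𝓡 n) (1 : G) g), ?_, ?_, ?_, ?_⟩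
  · exact (continuousOn_extChartAt (1 : G)).isOpen_inter_preimage
      (isOpen_extChartAt_source (1 : G)) Metric.isOpen_ball
  · exact ⟨mem_extChartAt_source (1 : G), Metric.mem_ball_self hr⟩
  · refine ContMDiffOn.comp hφs.contMDiffOn (contMDiffOn_extChartAt.mono fun g hg => ?_)
      fun g hg => hg.2
    rw [← extChartAt_source (𝓡 n)]
    exact hg.1
  · have hf : ∀ (v : LieAlg n G) (x : E), x ∈ (extChartAt (𝓡 n) (1 : G)).target →
        ∀ g, g = (extChartAt (𝓡 n) (1 : G)).symm x →
        (mfderiv (𝓡 n) 𝓘(ℝ, E) (extChartAt (𝓡 n) (1 : G)) g : E →L[ℝ] E)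
          (mulInvariantVectorField v g) = invariantFieldInChart v x := by
      rintro v x hx _ rfl
      have : IsManifold (𝓡 n) 1 G := .of_le (n := ∞) (by simp)
      have h1 := mfderiv_extChartAt_comp_mfderivWithin_extChartAt_symm (I := 𝓡 n) hx
      have h2 := mfderivWithin_extChartAt_symm_comp_mfderiv_extChartAt (I := 𝓡 n) hx
      rw [modelWithCornersSelf_coe, range_id, mfderivWithin_univ] at h1 h2
      rw [invariantFieldInChart, VectorField.mpullback_apply, ContinuousLinearMap.inverse_eq h2 h1]
      rfl
    intro g hg v
    have : IsManifold (𝓡 n) 1 G := .of_le (n := ∞) (by simp)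
    have h1 : MDifferentiableAt (𝓡 n) 𝓘(ℝ, E) (extChartAt (𝓡 n) (1 : G)) g :=
      mdifferentiableAt_extChartAt (by rw [← extChartAt_source (𝓡 n)]; exact hg.1)
    have h2 : MDifferentiableAt 𝓘(ℝ, E) 𝓘(ℝ, ℝ) φ (extChartAt (𝓡 n) (1 : G) g) :=
      (hφ _ hg.2).differentiableAt.mdifferentiableAt
    have hx : extChartAt (𝓡 n) (1 : G) g ∈ (extChartAt (𝓡 n) (1 : G)).target := hball hg.2
    have hgs : (extChartAt (𝓡 n) (1 : G)).symm (extChartAt (𝓡 n) (1 : G) g) = g :=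
      (extChartAt (𝓡 n) (1 : G)).left_inv hg.1
    have h3 : (mfderiv (𝓡 n) 𝓘(ℝ, ℝ) (fun g => φ (extChartAt (𝓡 n) (1 : G) g)) g : E →L[ℝ] ℝ) =
        (fderiv ℝ φ (extChartAt (𝓡 n) (1 : G) g)).comp
          (mfderiv (𝓡 n) 𝓘(ℝ, E) (extChartAt (𝓡 n) (1 : G)) g : E →L[ℝ] E) := by
      rw [← mfderiv_eq_fderiv]
      exact mfderiv_comp g h2 h1
    have h4 : (mfderiv (𝓡 n) 𝓘(ℝ, E) (extChartAt (𝓡 n) (1 : G)) g : E →L[ℝ] E)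
        (mulInvariantVectorField v g) =
        invariantFieldInChart v (extChartAt (𝓡 n) (1 : G) g) := 
      hf v _ hx g hgs.symm
    refine (congrArg (fun L : E →L[ℝ] ℝ => L (mulInvariantVectorField v g)) h3).trans ?_
    refine (congrArg (fderiv ℝ φ (extChartAt (𝓡 n) (1 : G) g)) h4).trans ?_
    rw [(hφ _ hg.2).fderiv]
    exact congrArg ℓ (fderiv_chart_invariantFieldInChart v hx)

end LocalPrimitive

/-! ### Global primitives on a simply connected group -/

section Primitive

variable {n : ℕ} {G : Type*} [TopologicalSpace G] [ChartedSpace (EuclideanSpace ℝ (Fin n)) G]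
  [Group G]

theorem invariantDeriv_congr_of_eventuallyEq {φ η : G → ℝ} {g : G} (h : φ =ᶠ[𝓝 g] η)
    (v : LieAlg n G) : invariantDeriv v φ g = invariantDeriv v η g := by
  have h1 : (mfderiv (𝓡 n) 𝓘(ℝ, ℝ) φ g : EuclideanSpace ℝ (Fin n) →L[ℝ] ℝ) =
      mfderiv (𝓡 n) 𝓘(ℝ, ℝ) η g := h.mfderiv_eq
  exact congrArg (fun L : EuclideanSpace ℝ (Fin n) →L[ℝ] ℝ => L (mulInvariantVectorField v g)) h1

theorem invariantDeriv_sub {φ η : G → ℝ} {g : G} (hφ : MDifferentiableAt (𝓡 n) 𝓘(ℝ, ℝ) φ g)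
    (hη : MDifferentiableAt (𝓡 n) 𝓘(ℝ, ℝ) η g) (v : LieAlg n G) :
    invariantDeriv v (fun x => φ x - η x) g = invariantDeriv v φ g - invariantDeriv v η g :=
  congrArg (fun L : EuclideanSpace ℝ (Fin n) →L[ℝ] ℝ => L (mulInvariantVectorField v g))
    (hφ.hasMFDerivAt.sub hη.hasMFDerivAt).mfderiv

theorem invariantDeriv_add_const {φ : G → ℝ} {g : G} (hφ : MDifferentiableAt (𝓡 n) 𝓘(ℝ, ℝ) φ g)
    (c : ℝ) (v : LieAlg n G) :
    invariantDeriv v (fun x => φ x + c) g = invariantDeriv v φ g := by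
  have h1 := (hφ.hasMFDerivAt.add (hasMFDerivAt_const c g)).mfderiv
  exact (congrArg (fun L : EuclideanSpace ℝ (Fin n) →L[ℝ] ℝ =>
    L (mulInvariantVectorField v g)) h1).trans (add_zero _)

theorem invariantDeriv_mul {φ η : G → ℝ} {g : G} (hφ : MDifferentiableAt (𝓡 n) 𝓘(ℝ, ℝ) φ g)
    (hη : MDifferentiableAt (𝓡 n) 𝓘(ℝ, ℝ) η g) (v : LieAlg n G) :
    invariantDeriv v (fun x => φ x * η x) g =
      φ g * invariantDeriv v η g + η g * invariantDeriv v φ g :=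
  congrArg (fun L : EuclideanSpace ℝ (Fin n) →L[ℝ] ℝ => L (mulInvariantVectorField v g))
    (hφ.hasMFDerivAt.mul hη.hasMFDerivAt).mfderiv

variable [LieGroup (𝓡 n) ∞ G]

/-- After left translation to the chart at the identity, the full derivative vanishes on a ball,
since left invariant fields span. -/
theorem eventually_eq_of_invariantDeriv_eq_zero {W : Set G} (hW : IsOpen W) {D : G → ℝ}
    (hD : ∀ g ∈ W, MDifferentiableAt (𝓡 n) 𝓘(ℝ, ℝ) D g)
    (h0 : ∀ g ∈ W, ∀ v : LieAlg n G, invariantDeriv v D g = 0) {g : G} (hg : g ∈ W) :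
    ∀ᶠ h in 𝓝 g, D h = D g := by
  let E := EuclideanSpace ℝ (Fin n)
  have : IsTopologicalGroup G := topologicalGroup_of_lieGroup (𝓡 n) ∞
  have hopen := isOpen_extChartAt_target (I := 𝓡 n) (1 : G)
  let f : E → G := fun x => (extChartAt (𝓡 n) (1 : G)).symm x
  have hV : IsOpen ((extChartAt (𝓡 n) (1 : G)).target ∩ f ⁻¹' ((fun h => g * h) ⁻¹' W)) :=
    (continuousOn_extChartAt_symm (1 : G)).isOpen_inter_preimage hopen
      (hW.preimage (continuous_const_mul g))
  have h1 : f (extChartAt (𝓡 n) (1 : G) 1) = 1 := extChartAt_to_inv 1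
  obtain ⟨r, hr, hball⟩ := Metric.isOpen_iff.1 hV (extChartAt (𝓡 n) (1 : G) 1)
    ⟨mem_extChartAt_target (I := 𝓡 n) (1 : G), by
      change g * f (extChartAt (𝓡 n) (1 : G) 1) ∈ W
      rwa [h1, mul_one]⟩
  have hder : ∀ x ∈ Metric.ball (extChartAt (𝓡 n) (1 : G) 1) r,
      HasFDerivAt (fun x => D (g * f x)) (0 : E →L[ℝ] ℝ) x := fun x hx => by
    have hxt := (hball hx).1
    have hDg : MDifferentiableAt (𝓡 n) 𝓘(ℝ, ℝ) D (g * f x) := hD _ (hball hx).2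
    have hDl : MDifferentiableAt (𝓡 n) 𝓘(ℝ, ℝ) (fun h => D (g * h)) (f x) :=
      MDifferentiableAt.comp (f x) hDg (mdifferentiable_const_mul g (f x))
    have hs : MDifferentiableAt 𝓘(ℝ, E) (𝓡 n) f x :=
      (contMDiffAt_extChartAt_one_symm hxt).mdifferentiableAt (by simp)
    set L : E →L[ℝ] ℝ := mfderiv (𝓡 n) 𝓘(ℝ, ℝ) (fun h => D (g * h)) (f x)
    set T : E →L[ℝ] E := mfderiv 𝓘(ℝ, E) (𝓡 n) f x
    have hc : HasFDerivAt (fun x => D (g * f x)) (L.comp T) x :=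
      (HasMFDerivAt.comp x hDl.hasMFDerivAt hs.hasMFDerivAt).hasFDerivAt
    have hz : L.comp T = 0 := by
      ext1 a
      rw [← invariantFieldInChart_fderiv_chart (G := G) a hxt]
      set v : LieAlg n G := fderiv ℝ (fun y => (extChartAt (𝓡 n) (1 : G))
        (((extChartAt (𝓡 n) (1 : G)).symm x)⁻¹ * (extChartAt (𝓡 n) (1 : G)).symm y)) x a
      have e2 : T (invariantFieldInChart v x) = mulInvariantVectorField v (f x) :=
        (isInvertible_mfderiv_extChartAt_one_symm hxt).self_apply_inverse _
      exact (congrArg L e2).trans ((invariantDeriv_comp_mul_left v hDg).trans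
        (h0 _ (hball hx).2 v))
    rwa [hz] at hc
  have hconst : ∀ x ∈ Metric.ball (extChartAt (𝓡 n) (1 : G) 1) r, D (g * f x) = D g := by
    intro x hx
    have : D (g * f x) = D (g * f (extChartAt (𝓡 n) (1 : G) 1)) :=
      Metric.isOpen_ball.is_const_of_fderiv_eq_zero (𝕜 := ℝ)
      (convex_ball (extChartAt (𝓡 n) (1 : G) 1) r).isPreconnected
      (fun y hy => (hder y hy).differentiableAt.differentiableWithinAt)
      (fun y hy => (hder y hy).fderiv) hx (Metric.mem_ball_self hr)
    rwa [h1, mul_one] at this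
  have hc : ContinuousAt (fun h => extChartAt (𝓡 n) (1 : G) (g⁻¹ * h)) g := by
    have h2 : ContinuousAt (extChartAt (𝓡 n) (1 : G)) (g⁻¹ * g) := by
      rw [inv_mul_cancel]; exact continuousAt_extChartAt (1 : G)
    exact ContinuousAt.comp (f := fun h => g⁻¹ * h) h2 (continuous_const_mul g⁻¹).continuousAt
  have hs : ∀ᶠ h in 𝓝 g, g⁻¹ * h ∈ (extChartAt (𝓡 n) (1 : G)).source := by
    refine (continuous_const_mul g⁻¹).continuousAt.eventually_mem ?_
    rw [inv_mul_cancel]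
    exact extChartAt_source_mem_nhds 1
  have hb : ∀ᶠ h in 𝓝 g, extChartAt (𝓡 n) (1 : G) (g⁻¹ * h) ∈
      Metric.ball (extChartAt (𝓡 n) (1 : G) 1) r := by
    refine hc.eventually_mem ?_
    rw [inv_mul_cancel]
    exact Metric.ball_mem_nhds _ hr
  filter_upwards [hs, hb] with h hhs hhb
  have := hconst _ hhb
  simp only [f] at this
  rwa [(extChartAt (𝓡 n) (1 : G)).left_inv hhs, mul_inv_cancel_left] at this

/-- The real line with the discrete topology. -/
structure DiscreteReal where
  /-- the underlying real number -/
  val : ℝ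

instance : TopologicalSpace DiscreteReal := ⊥
instance : DiscreteTopology DiscreteReal := ⟨rfl⟩

/-- On a simply connected group, a left invariant form that vanishes on brackets is exact. -/
theorem exists_primitive [SimplyConnectedSpace G] {ℓ : EuclideanSpace ℝ (Fin n) →L[ℝ] ℝ}
    (hℓ : ∀ v w : LieAlg n G, ℓ (⁅v, w⁆ : LieAlg n G) = 0) :
    ∃ F : G → ℝ, ContMDiff (𝓡 n) 𝓘(ℝ, ℝ) ∞ F ∧
      ∀ (g : G) (v : LieAlg n G), invariantDeriv v F g = ℓ v := by
  have : IsTopologicalGroup G := topologicalGroup_of_lieGroup (𝓡 n) ∞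
  obtain ⟨U, F, hU, h1U, hF, hFd⟩ := exists_local_primitive hℓ
  let f : G → G → ℝ := fun g h => F (g⁻¹ * h)
  let B : G → Set G := fun g => {h | g⁻¹ * h ∈ U}
  have hB : ∀ g, IsOpen (B g) := fun g => hU.preimage (continuous_const_mul g⁻¹)
  have hBg : ∀ g, g ∈ B g := fun g => by simpa [B] using h1U
  have hFU : ∀ g ∈ U, ContMDiffAt (𝓡 n) 𝓘(ℝ, ℝ) ∞ F g := fun g hg =>
    hF.contMDiffAt (hU.mem_nhds hg)
  have hfs : ∀ g, ∀ h ∈ B g, ContMDiffAt (𝓡 n) 𝓘(ℝ, ℝ) ∞ (f g) h := fun g h hh =>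
    ContMDiffAt.comp h (hFU _ hh) contMDiff_mul_left.contMDiffAt
  have hfd : ∀ g, ∀ h ∈ B g, ∀ v : LieAlg n G, invariantDeriv v (f g) h = ℓ v := fun g h hh v =>
    (invariantDeriv_comp_mul_left v ((hFU _ hh).mdifferentiableAt (by simp))).trans (hFd _ hh v)
  -- The covering of germs of primitives: (h, t) in the patch of g stands for the primitive near h
  -- whose value at h is f g h + t. Two local primitives differ by a locally constant function, so
  -- coordinate changes are continuous for the discrete fibre.
  let Z : FiberBundleCore G G DiscreteReal :=
    { baseSet := B
      isOpen_baseSet := hB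
      indexAt := id
      mem_baseSet_at := hBg
      coordChange := fun i j h t => ⟨t.val + (f i h - f j h)⟩
      coordChange_self := fun i h _ t => by
        rw [sub_self, add_zero]
      continuousOn_coordChange := fun i j => by
        rintro ⟨h, t⟩ ⟨hh, -⟩
        refine ContinuousAt.continuousWithinAt ?_
        have hd := eventually_eq_of_invariantDeriv_eq_zero ((hB i).inter (hB j))
          (D := fun h => f i h - f j h)
          (fun h hh => ((hfs i h hh.1).sub (hfs j h hh.2)).mdifferentiableAt (by simp))
          (fun h hh v => by
            rw [invariantDeriv_sub ((hfs i h hh.1).mdifferentiableAt (by simp))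
              ((hfs j h hh.2).mdifferentiableAt (by simp)), hfd i h hh.1, hfd j h hh.2, sub_self])
          hh
        refine continuousAt_const (y := (⟨t.val + (f i h - f j h)⟩ : DiscreteReal)) |>.congr ?_
        rw [nhds_prod_eq, nhds_discrete DiscreteReal, prod_pure, EventuallyEq, eventually_map]
        filter_upwards [hd] with h' hh'
        rw [hh']
      coordChange_comp := fun i j k h _ t => by
        rw [DiscreteReal.mk.injEq]
        ring }
  have hcov : IsCoveringMap Z.proj := FiberBundle.isCoveringMap (F := DiscreteReal) (E := Z.Fiber)
  have : LocallyPathConnectedSpace G :=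
    ChartedSpace.locallyPathConnectedSpace (EuclideanSpace ℝ (Fin n)) G
  -- Simple connectedness lifts the identity map to a global section. The value 0 over the identity
  -- is an arbitrary constant of integration.
  obtain ⟨s, ⟨-, hs⟩, -⟩ := hcov.existsUnique_continuousMap_lifts (ContinuousMap.id G) (a₀ := 1)
    (e₀ := ⟨1, (⟨0⟩ : DiscreteReal)⟩) rfl
  have hs1 : ∀ h, (s h).1 = h := fun h => congrFun hs h
  let Φ : G → ℝ := fun h => F (((s h).1)⁻¹ * h) + DiscreteReal.val (s h).2
  -- The section is locally constant in a trivialization, so Φ is locally a translated primitive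
  -- plus a constant.
  have hloc : ∀ g, ∃ c : ℝ, Φ =ᶠ[𝓝 g] fun h => f g h + c := fun g => by
    have hcont : ContinuousAt (fun h => (Z.localTriv g (s h)).2) g := by
      have h1 : ContinuousAt (Z.localTriv g) (s g) := by
        refine (Z.localTriv g).continuousAt ?_
        rw [Bundle.Trivialization.mem_source]
        change (s g).1 ∈ B g
        rw [hs1]
        exact hBg g
      exact continuous_snd.continuousAt.comp (h1.comp s.continuous.continuousAt)
    rw [ContinuousAt, nhds_discrete DiscreteReal, tendsto_pure] at hcont
    refine ⟨(Z.localTriv g (s g)).2.val, ?_⟩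
    filter_upwards [hcont] with h hh
    rw [← hh]
    change F (((s h).1)⁻¹ * h) + DiscreteReal.val (s h).2 =
      f g h + (DiscreteReal.val (s h).2 + (f (s h).1 (s h).1 - f g (s h).1))
    simp only [f, hs1]
    ring
  refine ⟨Φ, fun g => ?_, fun g v => ?_⟩
  · obtain ⟨c, hc⟩ := hloc g
    exact ((hfs g g (hBg g)).add contMDiffAt_const).congr_of_eventuallyEq hc
  · obtain ⟨c, hc⟩ := hloc g
    rw [invariantDeriv_congr_of_eventuallyEq hc, invariantDeriv_add_const
      ((hfs g g (hBg g)).mdifferentiableAt (by simp)), hfd g g (hBg g)]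

end Primitive

/-! ### Left invariant fields are divergence free -/

section IntegrationByParts

open scoped Pointwise

variable {n : ℕ} {G : Type*} [TopologicalSpace G] [ChartedSpace (EuclideanSpace ℝ (Fin n)) G]
  [Group G]

/-- A curve through the identity with velocity `v`. -/
noncomputable def chartCurve (G : Type*) [TopologicalSpace G]
    [ChartedSpace (EuclideanSpace ℝ (Fin n)) G] [Group G] (v : EuclideanSpace ℝ (Fin n)) (t : ℝ) :
    G :=
  (extChartAt (𝓡 n) (1 : G)).symm
    (extChartAt (𝓡 n) (1 : G) 1 + t • v)

theorem chartCurve_zero (v : EuclideanSpace ℝ (Fin n)) : chartCurve G v 0 = 1 := by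
  have : extChartAt (𝓡 n) (1 : G) 1 + (0 : ℝ) • v =
    extChartAt (𝓡 n) (1 : G) 1 := by rw [zero_smul, add_zero]
  rw [chartCurve, this]
  exact extChartAt_to_inv 1

theorem zero_mem_chartCurve_domain (v : EuclideanSpace ℝ (Fin n)) :
    extChartAt (𝓡 n) (1 : G) 1 + (0 : ℝ) • v ∈
      (extChartAt (𝓡 n) (1 : G)).target := by
  rw [zero_smul, add_zero]
  exact mem_extChartAt_target (I := 𝓡 n) (1 : G)

variable [LieGroup (𝓡 n) ∞ G]

theorem contMDiffAt_chartCurve (v : EuclideanSpace ℝ (Fin n)) {t : ℝ}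
    (ht : extChartAt (𝓡 n) (1 : G) 1 + t • v ∈
      (extChartAt (𝓡 n) (1 : G)).target) :
    ContMDiffAt 𝓘(ℝ, ℝ) (𝓡 n) ∞ (chartCurve G v) t := by
  have h : ContDiff ℝ ∞ fun t : ℝ =>
      extChartAt (𝓡 n) (1 : G) 1 + t • v := by fun_prop
  exact ContMDiffAt.comp t (contMDiffAt_extChartAt_one_symm ht) h.contMDiff.contMDiffAt

theorem hasDerivAt_comp_mul_chartCurve {φ : G → ℝ} {g : G} (v : EuclideanSpace ℝ (Fin n))
    (hφ : MDifferentiableAt (𝓡 n) 𝓘(ℝ, ℝ) φ g) :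
    HasDerivAt (fun t => φ (g * chartCurve G v t)) (invariantDeriv (v : LieAlg n G) φ g) 0 := by
  let E := EuclideanSpace ℝ (Fin n)
  have : IsManifold (𝓡 n) 1 G := .of_le (n := ∞) (by simp)
  let x₀ : E := extChartAt (𝓡 n) (1 : G) 1
  have hx₀ : x₀ ∈ (extChartAt (𝓡 n) (1 : G)).target := mem_extChartAt_target (I := 𝓡 n) (1 : G)
  have hs1 : (extChartAt (𝓡 n) (1 : G)).symm x₀ = 1 := extChartAt_to_inv 1
  have hf : HasMFDerivAt 𝓘(ℝ, E) (𝓡 n) (extChartAt (𝓡 n) (1 : G)).symm x₀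
      (ContinuousLinearMap.id ℝ E) := by
    have h1 := ((contMDiffAt_extChartAt_one_symm hx₀).mdifferentiableAt (by simp)).hasMFDerivAt
    have h2 := mfderivWithin_range_extChartAt_symm (I := 𝓡 n) (x := (1 : G))
    rw [modelWithCornersSelf_coe, range_id, mfderivWithin_univ] at h2
    have h3 : (mfderiv 𝓘(ℝ, E) (𝓡 n) (extChartAt (𝓡 n) (1 : G)).symm x₀ : E →L[ℝ] E) =
      ContinuousLinearMap.id ℝ E := h2
    exact h1.congr_mfderiv h3
  have hL : MDifferentiableAt (𝓡 n) 𝓘(ℝ, ℝ) (fun x => φ (g * x)) 1 :=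
    MDifferentiableAt.comp (1 : G) (by rwa [mul_one]) (mdifferentiable_const_mul g 1)
  have hL' : HasMFDerivAt (𝓡 n) 𝓘(ℝ, ℝ) (fun x => φ (g * x))
      ((extChartAt (𝓡 n) (1 : G)).symm x₀)
      (mfderiv (𝓡 n) 𝓘(ℝ, ℝ) (fun x => φ (g * x)) 1 : E →L[ℝ] ℝ) := by
    rw [hs1]; exact hL.hasMFDerivAt
  have hc : HasFDerivAt (fun x => φ (g * (extChartAt (𝓡 n) (1 : G)).symm x))
      (mfderiv (𝓡 n) 𝓘(ℝ, ℝ) (fun x => φ (g * x)) 1 : E →L[ℝ] ℝ) x₀ :=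
    (HasMFDerivAt.comp x₀ hL' hf).hasFDerivAt
  have hline : HasDerivAt (fun t : ℝ => x₀ + t • v) v 0 := by
    have h := ((hasDerivAt_id (0 : ℝ)).smul_const v).const_add x₀
    rw [one_smul] at h
    exact h
  have hc' : HasFDerivAt (fun x => φ (g * (extChartAt (𝓡 n) (1 : G)).symm x))
      (mfderiv (𝓡 n) 𝓘(ℝ, ℝ) (fun x => φ (g * x)) 1 : E →L[ℝ] ℝ) (x₀ + (0 : ℝ) • v) := by
    rwa [zero_smul, add_zero]
  have := hc'.comp_hasDerivAt (0 : ℝ) hline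
  have e : invariantDeriv (v : LieAlg n G) φ g =
      (mfderiv (𝓡 n) 𝓘(ℝ, ℝ) (fun x => φ (g * x)) 1 : E →L[ℝ] ℝ) v :=
    mfderiv_mulInvariantVectorField v hφ
  rw [e]
  exact this

/-- Smooth maps are locally Lipschitz, and compactness makes the constants uniform in g; this
supplies the bound for differentiation under the integral. -/
theorem exists_lipschitzOnWith_chartCurve {φ : G → ℝ} (hφ : ContMDiff (𝓡 n) 𝓘(ℝ, ℝ) ∞ φ)
    (v : EuclideanSpace ℝ (Fin n)) {K : Set G} (hK : IsCompact K) :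
    ∃ ε > 0, ∃ C : NNReal, ∀ g ∈ K,
      LipschitzOnWith C (fun t => φ (g * chartCurve G v t)) (Metric.ball 0 ε) := by
  let E := EuclideanSpace ℝ (Fin n)
  refine hK.induction_on (p := fun K => ∃ ε > 0, ∃ C : NNReal, ∀ g ∈ K,
      LipschitzOnWith C (fun t => φ (g * chartCurve G v t)) (Metric.ball 0 ε)) ?_ ?_ ?_ ?_
  · exact ⟨1, one_pos, 0, by simp⟩
  · rintro s t hst ⟨ε, hε, C, h⟩
    exact ⟨ε, hε, C, fun g hg => h g (hst hg)⟩
  · rintro s t ⟨ε, hε, C, h⟩ ⟨ε', hε', C', h'⟩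
    refine ⟨min ε ε', lt_min hε hε', max C C', ?_⟩
    rintro g (hg | hg)
    · exact ((h g hg).mono (Metric.ball_subset_ball (min_le_left _ _))).weaken (le_max_left _ _)
    · exact ((h' g hg).mono (Metric.ball_subset_ball (min_le_right _ _))).weaken (le_max_right _ _)
  · intro g₀ _
    let y₀ : E := extChartAt (𝓡 n) g₀ g₀
    have h1 : ContMDiffAt 𝓘(ℝ, E) (𝓡 n) ∞ (extChartAt (𝓡 n) g₀).symm y₀ :=
      (contMDiffOn_extChartAt_symm g₀).contMDiffAt
        ((isOpen_extChartAt_target g₀).mem_nhds (mem_extChartAt_target g₀))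
    have h2 : ContMDiffAt 𝓘(ℝ, E × ℝ) (𝓡 n) ∞
        (fun q : E × ℝ => (extChartAt (𝓡 n) g₀).symm q.1) (y₀, 0) :=
      ContMDiffAt.comp (y₀, (0 : ℝ)) h1 contDiff_fst.contMDiff.contMDiffAt
    have h3 : ContMDiffAt 𝓘(ℝ, E × ℝ) (𝓡 n) ∞ (fun q : E × ℝ => chartCurve G v q.2) (y₀, 0) :=
      ContMDiffAt.comp (g := chartCurve G v) (y₀, (0 : ℝ))
        (contMDiffAt_chartCurve v (zero_mem_chartCurve_domain (G := G) v))
        contDiff_snd.contMDiff.contMDiffAt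
    have h4 : ContDiffAt ℝ ∞ (fun q : E × ℝ =>
        φ ((extChartAt (𝓡 n) g₀).symm q.1 * chartCurve G v q.2)) (y₀, 0) :=
      (ContMDiffAt.comp (y₀, (0 : ℝ)) hφ.contMDiffAt (h2.mul h3)).contDiffAt
    obtain ⟨C, s, hs, hC⟩ := (h4.of_le (m := 1) (by simp)).exists_lipschitzOnWith
    obtain ⟨N, hN, T, hT, hNT⟩ := mem_nhds_prod_iff.1 hs
    obtain ⟨ε, hε, hεT⟩ := Metric.mem_nhds_iff.1 hT
    refine ⟨(extChartAt (𝓡 n) g₀).source ∩ extChartAt (𝓡 n) g₀ ⁻¹' N, ?_, ε, hε, C, ?_⟩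
    · exact mem_nhdsWithin_of_mem_nhds (inter_mem (extChartAt_source_mem_nhds g₀)
        ((continuousAt_extChartAt g₀).preimage_mem_nhds hN))
    · rintro g ⟨hgs, hgN⟩ t ht t' ht'
      have := hC (hNT (mk_mem_prod hgN (hεT ht))) (hNT (mk_mem_prod hgN (hεT ht')))
      simp only [(extChartAt (𝓡 n) g₀).left_inv hgs] at this
      refine this.trans ?_
      gcongr
      simp [Prod.edist_eq]

variable [T2Space G] [MeasurableSpace G] [BorelSpace G]

/-- Left invariant vector fields of a nilpotent group are divergence free. -/
theorem integral_invariantDeriv_eq_zero [Group.IsNilpotent G] (μ : Measure G) [μ.IsHaarMeasure]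
    {φ : G → ℝ} (hφ : ContMDiff (𝓡 n) 𝓘(ℝ, ℝ) ∞ φ) (hφc : HasCompactSupport φ) (v : LieAlg n G) :
    ∫ g, invariantDeriv v φ g ∂μ = 0 := by
  have : IsTopologicalGroup G := topologicalGroup_of_lieGroup (𝓡 n) ∞
  have : LocallyCompactSpace G := Manifold.locallyCompact_of_finiteDimensional (𝓡 n)
  let E := EuclideanSpace ℝ (Fin n)
  let w : E := v
  have hφcont : Continuous φ := hφ.continuous
  obtain ⟨r, hr, hrt⟩ : ∃ r : ℝ, 0 < r ∧ ∀ t ∈ Icc (-r) r,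
      extChartAt (𝓡 n) (1 : G) 1 + t • w ∈ (extChartAt (𝓡 n) (1 : G)).target := by
    have hc : Continuous fun t : ℝ => extChartAt (𝓡 n) (1 : G) 1 + t • w := by fun_prop
    have := hc.continuousAt.preimage_mem_nhds
      ((isOpen_extChartAt_target (1 : G)).mem_nhds (zero_mem_chartCurve_domain (G := G) w))
    obtain ⟨r, hr, h⟩ := Metric.nhds_basis_closedBall.mem_iff.1 this
    refine ⟨r, hr, fun t ht => h ?_⟩
    rwa [Real.closedBall_eq_Icc, zero_sub, zero_add]
  have hγ : ContinuousOn (chartCurve G w) (Icc (-r) r) := fun t ht =>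
    (contMDiffAt_chartCurve w (hrt t ht)).continuousAt.continuousWithinAt
  -- K contains the supports of all the right translates with t in [-r, r].
  set K : Set G := tsupport φ * (chartCurve G w '' Icc (-r) r)⁻¹ with hKdef
  have hK : IsCompact K := hφc.isCompact.mul (isCompact_Icc.image_of_continuousOn hγ).inv
  have hzero : ∀ g ∉ K, ∀ t ∈ Icc (-r) r, φ (g * chartCurve G w t) = 0 := by
    intro g hg t ht
    by_contra h
    refine hg ⟨g * chartCurve G w t, subset_tsupport φ h, (chartCurve G w t)⁻¹,
      by simpa using mem_image_of_mem _ ht, by simp⟩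
  obtain ⟨ε, hε, C, hC⟩ := exists_lipschitzOnWith_chartCurve hφ w hK
  set δ := min ε r with hδ
  have hδ0 : 0 < δ := lt_min hε hr
  have hFcont : ∀ t, Continuous fun g => φ (g * chartCurve G w t) := fun t =>
    hφcont.comp (continuous_mul_const _)
  have hF0 : (fun g => φ (g * chartCurve G w 0)) = φ := by
    ext g; rw [chartCurve_zero, mul_one]
  have hdiff : ∀ g, HasDerivAt (fun t => φ (g * chartCurve G w t)) (invariantDeriv v φ g) 0 :=
    fun g => hasDerivAt_comp_mul_chartCurve w (hφ.mdifferentiable (by simp) g)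
  have hmeas : AEStronglyMeasurable (fun g => invariantDeriv v φ g) μ := by
    have hseq : Tendsto (fun k : ℕ => (1 / ((k : ℝ) + 1))) atTop (𝓝[≠] 0) :=
      tendsto_nhdsWithin_iff.2 ⟨tendsto_one_div_add_atTop_nhds_zero_nat,
        Eventually.of_forall fun k => by
          have : (0 : ℝ) < 1 / ((k : ℝ) + 1) := by positivity
          exact this.ne'⟩
    refine aestronglyMeasurable_of_tendsto_ae atTop
      (f := fun (k : ℕ) g => slope (fun t => φ (g * chartCurve G w t)) 0 (1 / ((k : ℝ) + 1)))
      (fun k => ?_) (ae_of_all _ fun g => (hasDerivAt_iff_tendsto_slope.1 (hdiff g)).comp hseq)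
    simp only [slope_def_field]
    exact (((hFcont _).sub (hFcont _)).div_const _).aestronglyMeasurable
  have hint : Integrable (fun g => K.indicator (fun _ => (C : ℝ)) g) μ :=
    (integrable_indicator_iff hK.measurableSet).2
      (integrableOn_const hK.measure_lt_top.ne)
  have key := hasDerivAt_integral_of_dominated_loc_of_lip (μ := μ) (𝕜 := ℝ)
    (F := fun t g => φ (g * chartCurve G w t)) (x₀ := 0) (s := Metric.ball 0 δ)
    (bound := fun g => K.indicator (fun _ => (C : ℝ)) g) (F' := fun g => invariantDeriv v φ g)
    (Metric.ball_mem_nhds _ hδ0)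
    (Eventually.of_forall fun t => (hFcont t).aestronglyMeasurable)
    (by
      rw [hF0]
      exact hφcont.integrable_of_hasCompactSupport hφc)
    hmeas
    (ae_of_all _ fun g => by
      by_cases hg : g ∈ K
      · rw [indicator_of_mem hg]
        simpa using (hC g hg).mono (Metric.ball_subset_ball (min_le_left _ _))
      · rw [indicator_of_notMem hg]
        intro t ht t' ht'
        have hsub : Metric.ball (0 : ℝ) δ ⊆ Icc (-r) r := by
          rw [Real.ball_eq_Ioo, zero_sub, zero_add]
          exact Ioo_subset_Icc_self.trans
            (Icc_subset_Icc (neg_le_neg (min_le_right _ _)) (min_le_right _ _))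
        simp only
        rw [hzero g hg t (hsub ht), hzero g hg t' (hsub ht')]
        simp)
    hint (ae_of_all _ hdiff)
  -- Right invariance of μ: the integral does not depend on t, so its derivative at 0 vanishes.
  have hconst : (fun t => ∫ g, φ (g * chartCurve G w t) ∂μ) = fun _ => ∫ g, φ g ∂μ := by
    ext t
    exact integral_mul_right_eq_self_of_isNilpotent μ hφcont hφc _
  have h2 := key.2
  rw [hconst] at h2
  exact h2.unique (hasDerivAt_const 0 _)

end IntegrationByParts

/-! ### Multiplication operators on L² -/

section Multiplication

variable {α : Type*} [MeasurableSpace α] {ν : Measure α}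

theorem inner_L2_eq_integral_mul (f g : Lp ℝ 2 ν) :
    inner ℝ f g = ∫ x, f x * g x ∂ν := by
  rw [L2.inner_def]
  exact integral_congr_ae (ae_of_all _ fun x => by simp [mul_comm])

theorem integrable_mul_L2 (f g : Lp ℝ 2 ν) : Integrable (fun x => f x * g x) ν :=
  (Lp.memLp f).integrable_mul (Lp.memLp g)

/-- Multiplication by a bounded function, as an operator on `L²`. -/
theorem exists_mul_continuousLinearMap {x : α → ℝ} (hx : AEStronglyMeasurable x ν) {M : ℝ}
    (hM : ∀ᵐ a ∂ν, |x a| ≤ M) :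
    ∃ T : Lp ℝ 2 ν →L[ℝ] Lp ℝ 2 ν, ∀ f, T f =ᵐ[ν] fun a => x a * f a := by
  have hb : ∀ f : Lp ℝ 2 ν, ∀ᵐ a ∂ν, ‖x a * f a‖ ≤ M * ‖f a‖ := fun f => by
    filter_upwards [hM] with a ha
    rw [norm_mul]
    exact mul_le_mul_of_nonneg_right ha (norm_nonneg _)
  have hmem : ∀ f : Lp ℝ 2 ν, MemLp (fun a => x a * f a) 2 ν := fun f =>
    (Lp.memLp f).of_le_mul (hx.mul (Lp.aestronglyMeasurable f)) (hb f)
  let T : Lp ℝ 2 ν →ₗ[ℝ] Lp ℝ 2 ν :=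
    { toFun := fun f => (hmem f).toLp _
      map_add' := fun f g => by
        rw [← MemLp.toLp_add]
        refine MemLp.toLp_congr _ _ ?_
        filter_upwards [Lp.coeFn_add f g] with a ha
        change x a * (f + g : Lp ℝ 2 ν) a = x a * f a + x a * g a
        rw [ha, Pi.add_apply, mul_add]
      map_smul' := fun c f => by
        rw [RingHom.id_apply, ← MemLp.toLp_const_smul]
        refine MemLp.toLp_congr _ _ ?_
        filter_upwards [Lp.coeFn_smul c f] with a ha
        change x a * (c • f : Lp ℝ 2 ν) a = c * (x a * f a)
        rw [ha, Pi.smul_apply, smul_eq_mul, mul_left_comm] }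
  refine ⟨T.mkContinuous M fun f => Lp.norm_le_mul_norm_of_ae_le_mul ?_,
    fun f => (hmem f).coeFn_toLp⟩
  filter_upwards [(hmem f).coeFn_toLp, hb f] with a ha hba
  change ‖((hmem f).toLp _ : Lp ℝ 2 ν) a‖ ≤ _
  rwa [ha]

theorem inner_mul_left_eq_inner_mul_right {x : α → ℝ} {T : Lp ℝ 2 ν →L[ℝ] Lp ℝ 2 ν}
    (hT : ∀ f, T f =ᵐ[ν] fun a => x a * f a) (f g : Lp ℝ 2 ν) :
    inner ℝ (T f) g = inner ℝ f (T g) := by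
  rw [inner_L2_eq_integral_mul, inner_L2_eq_integral_mul]
  refine integral_congr_ae ?_
  filter_upwards [hT f, hT g] with a h1 h2
  rw [h1, h2]
  ring

end Multiplication

/-! ### The horizontal Sobolev space and the quadratic form -/

section Sobolev

theorem schrodingerForm_eq {G : Type*} [MeasurableSpace G] {d : ℕ} (μ : Measure G)
    (Ω : Set G) (V : G → ℝ)
    (q q' : L2 μ Ω × (Fin d → L2 μ Ω)) :
    schrodingerForm μ Ω V q q' =
      (∑ i, inner ℝ (q.2 i) (q'.2 i)) + ∫ x in Ω, V x * (q.1 x * q'.1 x) ∂μ := by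
  simp_rw [schrodingerForm, inner_L2_eq_integral_mul]

theorem schrodingerForm_comm {G : Type*} [MeasurableSpace G] {d : ℕ} (μ : Measure G)
    (Ω : Set G) (V : G → ℝ)
    (q q' : L2 μ Ω × (Fin d → L2 μ Ω)) :
    schrodingerForm μ Ω V q q' = schrodingerForm μ Ω V q' q := by
  simp_rw [schrodingerForm, mul_comm]

variable {n : ℕ} {G : Type*} [TopologicalSpace G] [ChartedSpace (EuclideanSpace ℝ (Fin n)) G]
  [Group G] [MeasurableSpace G] {d : ℕ}
  {μ : Measure G} {Ω : Set G} {e : Fin d → LieAlg n G} {V : G → ℝ}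

/-- Integration by parts in the horizontal Sobolev space. -/
theorem inner_add_inner_eq_zero_of_mem_horizontalSobolevZero [LieGroup (𝓡 n) ∞ G]
    [T2Space G] [BorelSpace G] [Group.IsNilpotent G] [μ.IsHaarMeasure]
    {q q' : L2 μ Ω × (Fin d → L2 μ Ω)}
    (hq : q ∈ horizontalSobolevZero μ Ω e) (hq' : q' ∈ horizontalSobolevZero μ Ω e) (j : Fin d) :
    inner ℝ q.1 (q'.2 j) + inner ℝ (q.2 j) q'.1 = 0 := by
  let B : L2 μ Ω × (Fin d → L2 μ Ω) → L2 μ Ω × (Fin d → L2 μ Ω) → ℝ :=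
    fun q q' => inner ℝ q.1 (q'.2 j) + inner ℝ (q.2 j) q'.1
  have hB : Continuous (Function.uncurry B) := by
    simp only [B, Function.uncurry_def]
    fun_prop
  -- Both sides are continuous, so test functions suffice; there it is the vanishing integral of
  -- Xⱼ(φη).
  have := map_mem_closure₂ (u := {(0 : ℝ)}) hB hq hq' ?_
  · simpa using this
  rintro q ⟨φ, ⟨hφ, hφc, hφΩ⟩, hqφ, hqd⟩ q' ⟨η, ⟨hη, -, -⟩, hqη, hqd'⟩
  rw [mem_singleton_iff]
  simp only [B]
  rw [inner_L2_eq_integral_mul, inner_L2_eq_integral_mul,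
    ← integral_add (integrable_mul_L2 _ _) (integrable_mul_L2 _ _)]
  have h1 : ∀ g, invariantDeriv (e j) (fun x => φ x * η x) g =
      φ g * invariantDeriv (e j) η g + η g * invariantDeriv (e j) φ g := fun g =>
    invariantDeriv_mul (hφ.mdifferentiable (by simp) g) (hη.mdifferentiable (by simp) g) _
  have h2 : ∫ g in Ω, (q.1 g * q'.2 j g + q.2 j g * q'.1 g) ∂μ =
      ∫ g in Ω, invariantDeriv (e j) (fun x => φ x * η x) g ∂μ := by
    refine integral_congr_ae ?_
    filter_upwards [hqφ, hqη, hqd j, hqd' j] with g e1 e2 e3 e4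
    rw [e1, e2, e3, e4, h1, mul_comm (η g)]
  rw [h2, setIntegral_eq_integral_of_forall_compl_eq_zero,
    integral_invariantDeriv_eq_zero μ (φ := fun x => φ x * η x) (hφ.mul hη) hφc.mul_right]
  intro g hg
  have hg' : (fun x => φ x * η x) =ᶠ[𝓝 g] fun _ => 0 := by
    have : φ =ᶠ[𝓝 g] 0 := notMem_tsupport_iff_eventuallyEq.1 fun h => hg (hφΩ h)
    filter_upwards [this] with x hx
    simp [hx]
  rw [invariantDeriv_congr_of_eventuallyEq hg', invariantDeriv, mfderiv_const]
  rfl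

/-- The action on pairs (function, horizontal gradient) of the multiplication by a function with
constant horizontal gradient `c`. -/
noncomputable def mulWithGradient {H : Type*} [NormedAddCommGroup H] [NormedSpace ℝ H]
    (T : H →L[ℝ] H) (c : Fin d → ℝ) (q : H × (Fin d → H)) : H × (Fin d → H) :=
  (T q.1, fun i => T (q.2 i) + c i • q.1)

theorem mulWithGradient_mem_horizontalSobolevZero {x : G → ℝ}
    (hx : ContMDiff (𝓡 n) 𝓘(ℝ, ℝ) ∞ x) {c : Fin d → ℝ}
    (hxc : ∀ i g, invariantDeriv (e i) x g = c i) {T : L2 μ Ω →L[ℝ] L2 μ Ω}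
    (hT : ∀ f, T f =ᵐ[μ.restrict Ω] fun a => x a * f a) {q : L2 μ Ω × (Fin d → L2 μ Ω)}
    (hq : q ∈ horizontalSobolevZero μ Ω e) :
    mulWithGradient T c q ∈ horizontalSobolevZero μ Ω e := by
  refine map_mem_closure (f := mulWithGradient T c) ?_ hq ?_
  · unfold mulWithGradient
    fun_prop
  rintro q ⟨φ, ⟨hφ, hφc, hφΩ⟩, hqφ, hqd⟩
  refine ⟨fun g => x g * φ g, ⟨hx.mul hφ, hφc.mul_left, ?_⟩, ?_, fun i => ?_⟩
  · exact (closure_mono (Function.support_mul_subset_right x φ)).trans hφΩ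
  · filter_upwards [hT q.1, hqφ] with g h1 h2
    rw [mulWithGradient, h1, h2]
  · filter_upwards [Lp.coeFn_add (T (q.2 i)) (c i • q.1), Lp.coeFn_smul (c i) q.1, hT (q.2 i),
      hqφ, hqd i] with g h1 h2 h3 h4 h5
    rw [invariantDeriv_mul (hx.mdifferentiable (by simp) g) (hφ.mdifferentiable (by simp) g)]
    simp only [mulWithGradient]
    rw [h1, Pi.add_apply, h2, Pi.smul_apply, h3, h4, h5, hxc, smul_eq_mul]
    ring

theorem mulWithGradient_mem_schrodingerFormDomain {x : G → ℝ}
    (hx : ContMDiff (𝓡 n) 𝓘(ℝ, ℝ) ∞ x) {c : Fin d → ℝ}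
    (hxc : ∀ i g, invariantDeriv (e i) x g = c i) {T : L2 μ Ω →L[ℝ] L2 μ Ω}
    (hT : ∀ f, T f =ᵐ[μ.restrict Ω] fun a => x a * f a)
    (hxm : AEStronglyMeasurable x (μ.restrict Ω)) {M : ℝ} (hM : ∀ᵐ a ∂μ.restrict Ω, |x a| ≤ M)
    {q : L2 μ Ω × (Fin d → L2 μ Ω)} (hq : q ∈ schrodingerFormDomain μ Ω e V) :
    mulWithGradient T c q ∈ schrodingerFormDomain μ Ω e V := by
  refine ⟨mulWithGradient_mem_horizontalSobolevZero hx hxc hT hq.1, ?_⟩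
  have h1 : Integrable (fun g => x g ^ 2 * (V g * q.1 g ^ 2)) (μ.restrict Ω) := by
    refine hq.2.bdd_mul (c := M ^ 2) (hxm.pow 2) ?_
    filter_upwards [hM] with g hg
    rw [norm_pow, Real.norm_eq_abs]
    exact pow_le_pow_left₀ (abs_nonneg _) hg 2
  refine h1.congr ?_
  filter_upwards [hT q.1] with g hg
  simp only [mulWithGradient]
  rw [hg]
  ring

/-- Weak form of [-Δ_H + V, x] = -2Xⱼ. Multiplication by x is symmetric, so only ⟨u, Xⱼv⟩ - ⟨Xⱼu, v⟩
survives, which integration by parts makes -2⟨Xⱼu, v⟩. -/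
theorem schrodingerForm_mulWithGradient [LieGroup (𝓡 n) ∞ G] [T2Space G] [BorelSpace G]
    [Group.IsNilpotent G] [μ.IsHaarMeasure] {x : G → ℝ} {j : Fin d} {T : L2 μ Ω →L[ℝ] L2 μ Ω}
    (hT : ∀ f, T f =ᵐ[μ.restrict Ω] fun a => x a * f a) {q q' : L2 μ Ω × (Fin d → L2 μ Ω)}
    (hq : q ∈ horizontalSobolevZero μ Ω e) (hq' : q' ∈ horizontalSobolevZero μ Ω e) :
    schrodingerForm μ Ω V (mulWithGradient T (Pi.single j 1) q) q' =
      schrodingerForm μ Ω V q (mulWithGradient T (Pi.single j 1) q') -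
        2 * inner ℝ (q.2 j) q'.1 := by
  have hibp := inner_add_inner_eq_zero_of_mem_horizontalSobolevZero hq hq' j
  have hV : ∫ g in Ω, V g * (T q.1 g * q'.1 g) ∂μ = ∫ g in Ω, V g * (q.1 g * T q'.1 g) ∂μ := by
    refine integral_congr_ae ?_
    filter_upwards [hT q.1, hT q'.1] with g h1 h2
    rw [h1, h2]
    ring
  rw [schrodingerForm_eq, schrodingerForm_eq]
  simp only [mulWithGradient]
  rw [hV]
  simp only [inner_add_left, inner_add_right, inner_smul_left, inner_smul_right,
    Finset.sum_add_distrib, inner_mul_left_eq_inner_mul_right hT, RCLike.conj_to_real]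
  simp only [Pi.single_apply, ite_mul, one_mul, zero_mul, Finset.sum_ite_eq', Finset.mem_univ,
    if_true]
  linarith

end Sobolev

/-! ### Sum rules -/

section SumRules

variable {n : ℕ} {G : Type*} [TopologicalSpace G] [ChartedSpace (EuclideanSpace ℝ (Fin n)) G]
  [Group G] [MeasurableSpace G] {d : ℕ} [LieGroup (𝓡 n) ∞ G] {μ : Measure G} {Ω : Set G}
  {e : Fin d → LieAlg n G} {V : G → ℝ} [T2Space G] [BorelSpace G]
  [Group.IsNilpotent G] [μ.IsHaarMeasure] {lam : ℕ → ℝ} {u : ℕ → L2 μ Ω}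

/-- The sum rules for the multiplication by a coordinate function of the first layer. -/
theorem exists_sum_rules (hspec : HasDiscreteDirichletSpectrum μ Ω e V lam u)
    {w : ℕ → Fin d → L2 μ Ω} (hw : ∀ i, (u i, w i) ∈ schrodingerFormDomain μ Ω e V)
    (hweak : ∀ i, ∀ q ∈ schrodingerFormDomain μ Ω e V,
      schrodingerForm μ Ω V (u i, w i) q = lam i * inner ℝ (u i) q.1)
    {x : G → ℝ} (hx : ContMDiff (𝓡 n) 𝓘(ℝ, ℝ) ∞ x) {j : Fin d}
    (hxc : ∀ i g, invariantDeriv (e i) x g = if i = j then 1 else 0)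
    {M : ℝ} (hM : ∀ᵐ a ∂μ.restrict Ω, |x a| ≤ M) :
    ∃ a : ℕ → ℕ → ℝ, (∀ i l, a i l = a l i) ∧
      (∀ i, HasSum (fun l => (lam l - lam i) * a i l ^ 2) 1) ∧
      ∀ i, HasSum (fun l => (lam l - lam i) ^ 2 * a i l ^ 2) (4 * ‖w i j‖ ^ 2) := by
  have hxm : AEStronglyMeasurable x (μ.restrict Ω) := hx.continuous.aestronglyMeasurable
  obtain ⟨T, hT⟩ := exists_mul_continuousLinearMap hxm hM
  have hxc' : ∀ i g, invariantDeriv (e i) x g = (Pi.single j 1 : Fin d → ℝ) i := fun i g => by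
    rw [hxc, Pi.single_apply]
  let b : HilbertBasis ℕ ℝ (L2 μ Ω) := HilbertBasis.mk hspec.orthonormal hspec.complete.ge
  have hb : ∀ l, b l = u l := fun l => by simp [b]
  -- Only the form is available, as x uᵢ need not lie in the operator domain: x u_l is tested
  -- against the equation of uᵢ, and x uᵢ against that of u_l.
  have hcomm : ∀ i l, inner ℝ ((-2 : ℝ) • w i j) (u l) =
      (lam l - lam i) * inner ℝ (T (u i)) (u l) := fun i l => by
    have h1 := schrodingerForm_mulWithGradient (V := V) (j := j) hT (hw i).1 (hw l).1
    have h2 := mulWithGradient_mem_schrodingerFormDomain hx hxc' hT hxm hM (hw i)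
    have h3 := mulWithGradient_mem_schrodingerFormDomain hx hxc' hT hxm hM (hw l)
    rw [hweak i _ h3, schrodingerForm_comm, hweak l _ h2] at h1
    simp only [mulWithGradient] at h1
    rw [← inner_mul_left_eq_inner_mul_right hT (u i), real_inner_comm _ (u l)] at h1
    rw [inner_smul_left, RCLike.conj_to_real]
    linarith
  -- The relation [Xⱼ, x] = 1: integrating by parts uᵢ against x uᵢ gives 2⟨Xⱼuᵢ, x uᵢ⟩ = -1.
  have hnorm : ∀ i, inner ℝ ((-2 : ℝ) • w i j) (T (u i)) = 1 := fun i => by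
    have h2 := mulWithGradient_mem_horizontalSobolevZero hx hxc' hT (hw i).1
    have h1 := inner_add_inner_eq_zero_of_mem_horizontalSobolevZero (hw i).1 h2 j
    simp only [mulWithGradient, Pi.single_eq_same, one_smul, inner_add_right] at h1
    rw [real_inner_self_eq_norm_sq, hspec.orthonormal.1 i,
      ← inner_mul_left_eq_inner_mul_right hT, real_inner_comm] at h1
    rw [inner_smul_left, RCLike.conj_to_real]
    linarith
  refine ⟨fun i l => inner ℝ (T (u i)) (u l), fun i l => ?_, fun i => ?_, fun i => ?_⟩
  · simp only
    rw [inner_mul_left_eq_inner_mul_right hT, real_inner_comm]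
  · have h := b.hasSum_inner_mul_inner ((-2 : ℝ) • w i j) (T (u i))
    rw [hnorm i] at h
    refine h.congr_fun fun l => ?_
    simp only [hb]
    rw [hcomm, real_inner_comm (T (u i))]
    ring
  · have h := b.hasSum_inner_mul_inner ((-2 : ℝ) • w i j) ((-2 : ℝ) • w i j)
    have e1 : inner ℝ ((-2 : ℝ) • w i j) ((-2 : ℝ) • w i j) = 4 * ‖w i j‖ ^ 2 := by
      rw [real_inner_self_eq_norm_sq, norm_smul, mul_pow]
      norm_num
    rw [e1] at h
    refine h.congr_fun fun l => ?_
    simp only [hb]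
    rw [real_inner_comm ((-2 : ℝ) • w i j), hcomm]
    ring

end SumRules

/-! ### Orthogonality to brackets, and positivity of the rank -/

section Stratification

variable {n : ℕ} {G : Type*} [TopologicalSpace G] [ChartedSpace (EuclideanSpace ℝ (Fin n)) G]
  [Group G] [LieGroup (𝓡 n) ∞ G] (C : CarnotGroup n G)

namespace CarnotGroup

theorem iSup_layer : ⨆ i, C.layer i = ⊤ :=
  C.layer_isInternal.submodule_iSup_eq_top

/-- Brackets lie in the layers of index at least 2, orthogonal to the first; this makes the
coordinate forms closed. -/
theorem scalar_bracket_eq_zero {x : LieAlg n G} (hx : x ∈ C.layer 1) (v w : LieAlg n G) :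
    C.scalar x (⁅v, w⁆ : LieAlg n G) = 0 := by
  have : LieGroup (𝓡 n) (minSmoothness ℝ 3) G :=
    .of_le (n := ∞) (by simpa using ofNat_three_le_infty)
  have hv : v ∈ ⨆ i, C.layer i := C.iSup_layer ▸ Submodule.mem_top
  have hw : w ∈ ⨆ i, C.layer i := C.iSup_layer ▸ Submodule.mem_top
  induction hv using Submodule.iSup_induction' with
  | zero => rw [zero_lie, map_zero]
  | add a b _ _ ha hb => rw [add_lie, map_add, ha, hb, add_zero]
  | mem i a ha =>
    induction hw using Submodule.iSup_induction' with
    | zero => rw [lie_zero, map_zero]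
    | add b c _ _ hb hc => rw [lie_add, map_add, hb, hc, add_zero]
    | mem j b hb =>
      rcases Nat.eq_zero_or_pos i with rfl | hi
      · rw [C.layer_zero, Submodule.mem_bot] at ha
        rw [ha, zero_lie, map_zero]
      rcases Nat.eq_zero_or_pos j with rfl | hj
      · rw [C.layer_zero, Submodule.mem_bot] at hb
        rw [hb, lie_zero, map_zero]
      · exact C.scalar_layer 1 (i + j) (by omega) x hx _ (C.bracket_mem i j hi hj a ha b hb)

/-- The first layer generates all the others. -/
theorem layer_eq_bot_of_rank_eq_zero (h : C.rank = 0) (j : ℕ) : C.layer j = ⊥ := by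
  have : LieGroup (𝓡 n) (minSmoothness ℝ 3) G :=
    .of_le (n := ∞) (by simpa using ofNat_three_le_infty)
  have : FiniteDimensional ℝ (LieAlg n G) :=
    inferInstanceAs (FiniteDimensional ℝ (EuclideanSpace ℝ (Fin n)))
  have h1 : C.layer 1 = ⊥ := Submodule.finrank_eq_zero.1 h
  rcases j with _ | _ | j
  · exact C.layer_zero
  · exact h1
  by_cases hj : j + 1 < C.step
  · rw [← C.bracket_layer_one (j + 1) (by omega) hj, Submodule.span_eq_bot]
    rintro z ⟨x, hx, y, -, rfl⟩
    rw [h1, Submodule.mem_bot] at hx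
    rw [hx, zero_lie]
  · exact C.layer_of_step_lt _ (by omega)

theorem subsingleton_of_rank_eq_zero (h : C.rank = 0) : Subsingleton G := by
  have htop : (⊤ : Submodule ℝ (LieAlg n G)) = ⊥ := by
    rw [← C.iSup_layer]
    exact iSup_eq_bot.2 (C.layer_eq_bot_of_rank_eq_zero h)
  have hn : n = 0 := by
    have h1 : Module.finrank ℝ (LieAlg n G) = n := finrank_euclideanSpace_fin
    rw [← h1, ← finrank_top, htop, finrank_bot]
  subst hn
  have : DiscreteTopology G := ChartedSpace.discreteTopology (EuclideanSpace ℝ (Fin 0)) G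
  have := C.simplyConnected
  exact PreconnectedSpace.trivial_of_discrete

end CarnotGroup

end Stratification

section Rank

/-- Over at most one point L² has dimension at most one. This excludes rank zero, where division by
d would be meaningless. -/
theorem not_orthonormal_of_subsingleton {α : Type*} [MeasurableSpace α] [Subsingleton α]
    {ν : Measure α} (u : ℕ → Lp ℝ 2 ν) : ¬ Orthonormal ℝ u := fun hu => by
  have h01 := hu.2 (show (0 : ℕ) ≠ 1 by simp)
  have h0 := hu.1 0
  have h1 := hu.1 1
  rcases isEmpty_or_nonempty α with hα | ⟨⟨x⟩⟩
  · have : u 0 = 0 := Lp.ext (ae_of_all _ fun y => hα.elim y)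
    simp [this] at h0
  have hlin : u 1 x • u 0 = u 0 x • u 1 := by
    refine Lp.ext ?_
    filter_upwards [Lp.coeFn_smul (u 1 x) (u 0), Lp.coeFn_smul (u 0 x) (u 1)] with y e0 e1
    rw [e0, e1, Subsingleton.elim y x]
    simp [mul_comm]
  have hx : ∀ j, ‖u j‖ = 1 → u j x ≠ 0 := fun j hj hx => by
    have : u j = 0 := by
      refine Lp.ext ?_
      filter_upwards [Lp.coeFn_zero ℝ 2 ν] with y hy
      rw [hy, Subsingleton.elim y x, hx, Pi.zero_apply]
    simp [this] at hj
  have h := congrArg (fun f => inner ℝ f (u 0)) hlin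
  simp only [inner_smul_left, RCLike.conj_to_real, real_inner_self_eq_norm_sq, h0] at h
  rw [real_inner_comm, h01] at h
  exact hx 1 h1 (by simpa using h)

end Rank

/-! ### Eigenvalue inequalities -/

section Eigenvalues

variable {n : ℕ} {G : Type*} [TopologicalSpace G] [ChartedSpace (EuclideanSpace ℝ (Fin n)) G]
  [Group G] [MeasurableSpace G] {μ : Measure G} {Ω : Set G} {V : G → ℝ} {lam : ℕ → ℝ}
  {u : ℕ → L2 μ Ω}

/-- The gradient identity comes from testing the equation of uᵢ with uᵢ itself. -/
theorem HasDiscreteDirichletSpectrum.exists_gradient {d : ℕ} {e : Fin d → LieAlg n G}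
    (hspec : HasDiscreteDirichletSpectrum μ Ω e V lam u) :
    ∃ w : ℕ → Fin d → L2 μ Ω, (∀ i, (u i, w i) ∈ schrodingerFormDomain μ Ω e V) ∧
      (∀ i, ∀ q ∈ schrodingerFormDomain μ Ω e V,
        schrodingerForm μ Ω V (u i, w i) q = lam i * inner ℝ (u i) q.1) ∧
      ∀ i, ∑ j, ‖w i j‖ ^ 2 = lam i - ∫ x in Ω, V x * u i x ^ 2 ∂μ := by
  choose w hw hweak using hspec.eigen
  have h : ∀ i, ∀ q ∈ schrodingerFormDomain μ Ω e V,
      schrodingerForm μ Ω V (u i, w i) q = lam i * inner ℝ (u i) q.1 := fun i q hq => by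
    rw [hweak i q hq, ← inner_L2_eq_integral_mul, real_inner_smul_left]
  refine ⟨w, hw, h, fun i => ?_⟩
  have h1 := h i _ (hw i)
  rw [schrodingerForm_eq, real_inner_self_eq_norm_sq, hspec.orthonormal.1 i] at h1
  simp only [real_inner_self_eq_norm_sq, ← pow_two] at h1
  linarith

theorem HasDiscreteDirichletSpectrum.integral_potential_le {d : ℕ} {e : Fin d → LieAlg n G}
    (hspec : HasDiscreteDirichletSpectrum μ Ω e V lam u) (i : ℕ) :
    ∫ x in Ω, V x * u i x ^ 2 ∂μ ≤ lam i := by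
  obtain ⟨w, -, -, h⟩ := hspec.exists_gradient
  have : 0 ≤ ∑ j, ‖w i j‖ ^ 2 := Finset.sum_nonneg fun j _ => sq_nonneg _
  linarith [h i]

theorem HasDiscreteDirichletSpectrum.le_integral_potential {d : ℕ} {e : Fin d → LieAlg n G}
    (hspec : HasDiscreteDirichletSpectrum μ Ω e V lam u) (hΩ : MeasurableSet Ω) {m : ℝ}
    (hm : ∀ x ∈ Ω, m ≤ V x) (i : ℕ) : m ≤ ∫ x in Ω, V x * u i x ^ 2 ∂μ := by
  obtain ⟨w, hw, -, -⟩ := hspec.exists_gradient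
  have h1 : ∫ x in Ω, u i x * u i x ∂μ = 1 := by
    rw [← inner_L2_eq_integral_mul, real_inner_self_eq_norm_sq, hspec.orthonormal.1 i, one_pow]
  calc m = ∫ x in Ω, m * (u i x * u i x) ∂μ := by rw [integral_const_mul, h1, mul_one]
    _ ≤ ∫ x in Ω, V x * u i x ^ 2 ∂μ := by
      refine integral_mono_ae ((integrable_mul_L2 _ _).const_mul m) (hw i).2 ?_
      filter_upwards [ae_restrict_mem hΩ] with x hx
      simp only [← pow_two]
      exact mul_le_mul_of_nonneg_right (hm x hx) (sq_nonneg _)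

variable [T2Space G] [LieGroup (𝓡 n) ∞ G] [BorelSpace G] [μ.IsHaarMeasure]

/-- The Yang type inequality, with `lam k` replaced by any number separating the first `k`
eigenvalues from the others. -/
theorem CarnotGroup.sum_rpow_sub_eigenvalue_le (C : CarnotGroup n G) (hrank : C.rank ≠ 0)
    {e : Fin C.rank → LieAlg n G} (he : C.IsHorizontalFrame e) (hΩ : MeasurableSet Ω)
    (hΩ_bdd : IsCompact (closure Ω)) (hspec : HasDiscreteDirichletSpectrum μ Ω e V lam u)
    {k : ℕ} {z p : ℝ} (hlt : ∀ i < k, lam i ≤ z) (hge : ∀ l, k ≤ l → z ≤ lam l)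
    (hp : 1 ≤ p ∨ ∀ i < k, lam i < z) :
    ∑ i ∈ Finset.range k, (z - lam i) ^ p ≤
      max 4 (2 * p) / (C.rank : ℝ) * ∑ i ∈ Finset.range k, (z - lam i) ^ (p - 1) *
        (lam i - ∫ x in Ω, V x * u i x ^ 2 ∂μ) := by
  have := C.simplyConnected
  have := C.nilpotent
  obtain ⟨w, hw, hweak, hgrad⟩ := hspec.exists_gradient
  have hd : (0 : ℝ) < C.rank := by exact_mod_cast Nat.pos_of_ne_zero hrank
  have key : ∀ j : Fin C.rank, ∑ i ∈ Finset.range k, (z - lam i) ^ p ≤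
      max 4 (2 * p) * ∑ i ∈ Finset.range k, (z - lam i) ^ (p - 1) * ‖w i j‖ ^ 2 := fun j => by
    have hej : e j ∈ C.layer 1 := he.1 ▸ Submodule.subset_span (mem_range_self j)
    let ℓ : EuclideanSpace ℝ (Fin n) →L[ℝ] ℝ :=
      LinearMap.toContinuousLinearMap (E := EuclideanSpace ℝ (Fin n)) (C.scalar (e j))
    obtain ⟨x, hx, hxv⟩ := exists_primitive (G := G) (ℓ := ℓ)
      fun v w => C.scalar_bracket_eq_zero hej v w
    obtain ⟨M, hM⟩ := hΩ_bdd.exists_bound_of_continuousOn hx.continuous.continuousOn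
    have hM' : ∀ᵐ a ∂μ.restrict Ω, |x a| ≤ M := by
      filter_upwards [ae_restrict_mem hΩ] with a ha
      exact hM a (subset_closure ha)
    obtain ⟨a, hsymm, hS, hT⟩ := exists_sum_rules hspec hw hweak hx (j := j) (fun i g => by
      rw [hxv]
      exact (he.2 j i).trans (if_congr eq_comm rfl rfl)) hM'
    have h := sum_rpow_mul_tsum_le hsymm hlt hge hp hS hT
    -- The factor 4 is that of 4‖Xⱼuᵢ‖² in the second sum rule.
    have hmax : max 4 (2 * p) = 4 * max 1 (p / 2) := by
      rw [mul_max_of_nonneg _ _ (by norm_num)]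
      ring_nf
    calc _ = ∑ i ∈ Finset.range k, (z - lam i) ^ p * 1 := by simp
      _ ≤ _ := h
      _ = _ := by
        rw [hmax, Finset.mul_sum, Finset.mul_sum]
        exact Finset.sum_congr rfl fun i _ => by ring
  have hsum := Finset.sum_le_sum fun j (_ : j ∈ Finset.univ) => key j
  rw [Finset.sum_const, Finset.card_univ, Fintype.card_fin, nsmul_eq_mul, ← Finset.mul_sum,
    Finset.sum_comm] at hsum
  simp only [← Finset.mul_sum, hgrad] at hsum
  rwa [div_mul_eq_mul_div, le_div_iff₀' hd]

end Eigenvalues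

/-! ### The main theorem -/

theorem theorem7p1 {n : ℕ} {G : Type*} [TopologicalSpace G] [T2Space G]
    [SecondCountableTopology G] [ChartedSpace (EuclideanSpace ℝ (Fin n)) G] [Group G]
    [LieGroup (𝓡 n) ∞ G] [MeasurableSpace G] [BorelSpace G]
    (C : CarnotGroup n G) (μ : Measure G) [μ.IsHaarMeasure]
    (e : Fin C.rank → LieAlg n G) (he : C.IsHorizontalFrame e)
    (Ω : Set G) (hΩ_open : IsOpen Ω) (hΩ_conn : IsConnected Ω) (hΩ_bdd : IsCompact (closure Ω))
    (V : G → ℝ) (hV : AEMeasurable V (μ.restrict Ω))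
    (lam : ℕ → ℝ) (u : ℕ → L2 μ Ω) (hspec : HasDiscreteDirichletSpectrum μ Ω e V lam u) :
    (∀ k : ℕ, 1 ≤ k → ∀ p : ℝ, (1 ≤ p ∨ ∀ i < k, lam i < lam k) →
      ∑ i ∈ Finset.range k, (lam k - lam i) ^ p ≤
        max 4 (2 * p) / (C.rank : ℝ) *
          ∑ i ∈ Finset.range k, (lam k - lam i) ^ (p - 1) *
            (lam i - ∫ x in Ω, V x * u i x ^ 2 ∂μ)) ∧
    (BddBelow (V '' Ω) → ∀ k : ℕ, 1 ≤ k →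
      lam k ≤ (1 + 4 / (C.rank : ℝ)) * ((1 / (k : ℝ)) * ∑ i ∈ Finset.range k, lam i)
          - 4 / (C.rank : ℝ) * sInf (V '' Ω) ∧
      lam k ≤ (1 + 4 / (C.rank : ℝ)) * (k : ℝ) ^ (2 / (C.rank : ℝ)) * lam 0
          - ((1 + 4 / (C.rank : ℝ)) * (k : ℝ) ^ (2 / (C.rank : ℝ)) - 1) * sInf (V '' Ω)) := by
  have hrank : C.rank ≠ 0 := fun h => by
    have := C.subsingleton_of_rank_eq_zero h
    exact not_orthonormal_of_subsingleton u hspec.orthonormal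
  have hd : (0 : ℝ) < C.rank := by exact_mod_cast Nat.pos_of_ne_zero hrank
  have yang := fun {k : ℕ} {z p : ℝ} => C.sum_rpow_sub_eigenvalue_le hrank he
    hΩ_open.measurableSet hΩ_bdd hspec (k := k) (z := z) (p := p)
  have hmono := hspec.monotone
  refine ⟨fun k _ p hp => yang (fun i hi => hmono hi.le) (fun l hl => hmono hl) hp,
    fun hbdd => ?_⟩
  generalize hm : sInf (V '' Ω) = m
  have hmV : ∀ x ∈ Ω, m ≤ V x := fun x hx => hm ▸ csInf_le hbdd (mem_image_of_mem V hx)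
  have hmT := hspec.le_integral_potential hΩ_open.measurableSet hmV
  -- The case p = 1, linear in `lam k`, which is λ_{k+1} as indices start at 0. The weights x^0 are
  -- 1 even at x = 0.
  have hmean : ∀ k : ℕ, 1 ≤ k → lam k ≤ (1 + 4 / (C.rank : ℝ)) *
      ((1 / (k : ℝ)) * ∑ i ∈ Finset.range k, lam i) - 4 / (C.rank : ℝ) * m := fun k hk => by
    have hk' : (0 : ℝ) < k := by exact_mod_cast hk
    have h := yang (k := k) (p := 1) (fun i hi => hmono hi.le) (fun l hl => hmono hl)
      (Or.inl le_rfl)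
    have h4 : max (4 : ℝ) (2 * 1) = 4 := by norm_num
    simp only [Real.rpow_one, sub_self, Real.rpow_zero, one_mul, h4] at h
    have h2 : ∑ i ∈ Finset.range k, (lam i - ∫ x in Ω, V x * u i x ^ 2 ∂μ) ≤
        ∑ i ∈ Finset.range k, (lam i - m) :=
      Finset.sum_le_sum fun i _ => sub_le_sub_left (hmT i) _
    have h3 := h.trans (mul_le_mul_of_nonneg_left h2 (by positivity))
    simp only [Finset.sum_sub_distrib, Finset.sum_const, Finset.card_range, nsmul_eq_mul] at h3
    refine le_of_mul_le_mul_left ?_ hk'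
    have e1 : (k : ℝ) * ((1 + 4 / (C.rank : ℝ)) * ((1 / (k : ℝ)) * ∑ i ∈ Finset.range k, lam i)
        - 4 / (C.rank : ℝ) * m) = (1 + 4 / (C.rank : ℝ)) * ∑ i ∈ Finset.range k, lam i
        - 4 / (C.rank : ℝ) * (k * m) := by
      field_simp
    rw [e1]
    linarith
  refine fun k hk => ⟨hmean k hk, ?_⟩
  -- If λ₁ were inf V, the bound by the mean would inductively force every eigenvalue to equal it,
  -- contradicting divergence to infinity.
  have hpos : 0 < lam 0 - m := by
    refine lt_of_le_of_ne (sub_nonneg.2 ((hmT 0).trans (hspec.integral_potential_le 0)))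
      fun h0 => ?_
    have hconst : ∀ l, lam l = m := fun l => by
      induction l using Nat.strong_induction_on with
      | _ l ih =>
        rcases Nat.eq_zero_or_pos l with rfl | hl
        · linarith
        refine le_antisymm ?_ (by linarith [hmono (Nat.zero_le l)])
        have hl' : (l : ℝ) ≠ 0 := by exact_mod_cast hl.ne'
        have h := hmean l hl
        rw [Finset.sum_congr rfl fun i hi => ih i (Finset.mem_range.1 hi), Finset.sum_const,
          Finset.card_range, nsmul_eq_mul, one_div, inv_mul_cancel_left₀ hl'] at h
        linarith
    obtain ⟨l, hl⟩ := (hspec.tendsto.eventually_gt_atTop m).exists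
    exact hl.ne' (hconst l)
  -- The shift by m = inf V leaves differences unchanged and, as Tᵢ ≥ m, bounds λᵢ - Tᵢ by the
  -- shifted eigenvalue. So p = 2 is Yang's inequality without potential.
  have hweyl := le_rpow_mul_of_yang (lam := fun i => lam i - m)
    (fun i l hil => sub_le_sub_right (hmono hil) m) hpos hd (fun k z hlt hge => by
      have h := yang (k := k) (z := z + m) (p := 2) (fun i hi => by linarith [hlt i hi])
        (fun l hl => by linarith [hge l hl]) (Or.inl one_le_two)
      have h4 : max (4 : ℝ) (2 * 2) = 4 := by norm_num
      have h1 : (2 : ℝ) - 1 = 1 := by norm_num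
      simp only [Real.rpow_two, h4, h1, Real.rpow_one] at h
      have e1 : ∀ i, z - (lam i - m) = z + m - lam i := fun i => by ring
      simp only [e1]
      refine h.trans (mul_le_mul_of_nonneg_left (Finset.sum_le_sum fun i hi => ?_)
        (by positivity))
      exact mul_le_mul_of_nonneg_left (sub_le_sub_left (hmT i) _)
        (by linarith [hlt i (Finset.mem_range.1 hi)])) hk
  linarith
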